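/- Let $T:\mathbb{Z}\to\mathbb{Z}$ be the Tribonacci sequence, defined by $T(0)=0$, $T(1)=T(2)=1$ and $T(n+3)=T(n+2)+T(n+1)+T(n)$ for all $n\in\mathbb{Z}$, and let $\mathcal{Z}_T=\{0,-1,-4,-17\}$, the set of integers at which $T$ vanishes. For a prime $p$ and a nonzero integer $m$ let $\nu_p(m)$ be the exponent of $p$ in the factorization of $m$, and let $\nu_p(0)=\infty$. For a prime $p$, the Marques–Lengyel conjecture for $p$ is the following assertion: there exists a positive integer $Q$ such that for every $i\in\{0,1,\dots,Q-1\}$ at least one of the following two options holds. (C) There exists $\kappa_i\in\mathbb{Z}_{\ge 0}$ such that $\nu_p(T(n))=\kappa_i$ for all but finitely many $n\in\mathbb{Z}$ with $n\equiv i\pmod Q$. (L) There exist $a_i\in\mathbb{Z}$, $\kappa_i\in\mathbb{Z}$ and $\mu_i\in\mathbb{Z}_{>0}$ with $\nu_p(a_i-i)\ge\nu_p(Q)$ such that $\nu_p(T(n))=\kappa_i+\mu_i\,\nu_p(n-a_i)$ for all but finitely many $n\in\mathbb{Z}$ with $n\equiv i\pmod Q$. Theorem. (i) The Marques–Lengyel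 conjecture fails for every prime $p\in[5,599]\setminus\{11,83,103,163,397\}$. (ii) The Marques–Lengyel conjecture holds for $p\in\{83,397\}$, in the following form: with $Q_{83}=287$ and $Q_{397}=132$, for every $n\in\mathbb{Z}$, $$\nu_p(T(n))=\begin{cases}\nu_p(n+c)+1, & \text{if } n\equiv -c\pmod{Q_p} \text{ for some integer } c \text{ with } -c\in\mathcal{Z}_T,\\ 0, & \text{otherwise.}\end{cases}$$ -/

import Mathlib

/-- Forward Tribonacci numbers `T(0), T(1), T(2), …`. -/
def tribForward : ℕ → ℤ
  | 0 => 0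
  | 1 => 1
  | 2 => 1
  | n + 3 => tribForward (n + 2) + tribForward (n + 1) + tribForward n

/-- Backward Tribonacci numbers `T(0), T(-1), T(-2), …`, obtained by running the
recurrence in the form `T(m) = T(m+3) - T(m+2) - T(m+1)`. -/
def tribBackward : ℕ → ℤ
  | 0 => 0
  | 1 => 0
  | 2 => 1
  | n + 3 => tribBackward n - tribBackward (n + 1) - tribBackward (n + 2)

/-- The Tribonacci sequence `T : ℤ → ℤ`. -/
def trib : ℤ → ℤ
  | Int.ofNat n => tribForward n
  | Int.negSucc n => tribBackward (n + 1)

theorem trib_zero : trib 0 = 0 := rfl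

theorem trib_one : trib 1 = 1 := rfl

theorem trib_two : trib 2 = 1 := rfl

/-- The defining recurrence, valid at every integer. -/
theorem trib_add_three (n : ℤ) :
    trib (n + 3) = trib (n + 2) + trib (n + 1) + trib n := by
  rcases n with n | n
  · rfl
  · match n with
    | 0 => rfl
    | 1 => rfl
    | 2 => rfl
    | k + 3 =>
      have e1 : Int.negSucc (k + 3) + 3 = Int.negSucc k := by omega
      have e2 : Int.negSucc (k + 3) + 2 = Int.negSucc (k + 1) := by omega
      have e3 : Int.negSucc (k + 3) + 1 = Int.negSucc (k + 2) := by omega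
      rw [e1, e2, e3]
      have h : tribBackward (k + 4) =
          tribBackward (k + 1) - tribBackward (k + 2) - tribBackward (k + 3) := rfl
      change tribBackward (k + 1) =
        tribBackward (k + 2) + tribBackward (k + 3) + tribBackward (k + 4)
      rw [h]
      ring

/-- The set `{0, -1, -4, -17}` of zeros of the Tribonacci sequence. -/
def tribZeros : Set ℤ := {0, -1, -4, -17}

/-- The exponent of `p` in the integer `m`, with the convention `nuP p 0 = ⊤ = ∞`. -/
def nuP (p : ℕ) (m : ℤ) : WithTop ℤ :=
  if m = 0 then ⊤ else ((padicValInt p m : ℤ) : WithTop ℤ)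

/-- Option (C) on the class `i` modulo `Q`: up to finitely many exceptions, the valuation of
`T(n)` is a constant `κ`. -/
def MLConstant (p Q : ℕ) (i : ℤ) : Prop :=
  ∃ κ : ℕ, {n : ℤ | n ≡ i [ZMOD Q] ∧ nuP p (trib n) ≠ ((κ : ℤ) : WithTop ℤ)}.Finite

/-- Option (L) on the class `i` modulo `Q`: up to finitely many exceptions, the valuation of
`T(n)` is `κ + μ ν_p(n - a)`. -/
def MLLinear (p Q : ℕ) (i : ℤ) : Prop :=
  ∃ a κ μ : ℤ, 0 < μ ∧ nuP p (Q : ℤ) ≤ nuP p (a - i) ∧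
    {n : ℤ | n ≡ i [ZMOD Q] ∧
      nuP p (trib n) ≠ (κ : WithTop ℤ) + (μ : WithTop ℤ) * nuP p (n - a)}.Finite

/-- The Marques–Lengyel conjecture for the prime `p`. -/
def MLConjecture (p : ℕ) : Prop :=
  ∃ Q : ℕ, 0 < Q ∧ ∀ i : ℤ, 0 ≤ i → i < Q → MLConstant p Q i ∨ MLLinear p Q i

/-- For every integer `n`, the valuation of `T(n)` is `ν_p(n + c) + 1` if
`n ≡ -c (mod Q)` with `-c` a zero of the Tribonacci sequence, and `0` otherwise. -/
def TribValuationFormula (p Q : ℕ) : Prop :=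
  ∀ n : ℤ,
    (∀ c : ℤ, -c ∈ tribZeros → n ≡ -c [ZMOD Q] → nuP p (trib n) = nuP p (n + c) + 1) ∧
    ((¬ ∃ c : ℤ, -c ∈ tribZeros ∧ n ≡ -c [ZMOD Q]) → nuP p (trib n) = 0)

/-!
Write `T(n)` by Binet's formula `D T(n) = Σ λᵢ^(n+1) (λⱼ - λₖ)` with the roots `λ₁, λ₂, λ₃` of
`X³ - X² - X - 1`, where `D² = -44`.

If `N` is a period of `T` modulo an odd prime `p`, Newton's expansion gives
`T(k + mN) ≡ T(k) + m (T(k + N) - T(k))` modulo `p² m` (`trib_shift_congr`). On a residue class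
modulo `N` the sequence is therefore, up to a factor `p`, a `p`-adic isometry whenever
`T(k + N) - T(k)` is not divisible by `p²`, and it has exactly one `p`-adic zero there if `p ∣ T(k)`.

For `p = 83` and `p = 397`, with `Q` as the period, the only classes modulo `Q` on which `p` divides
`T` are those of the four integer zeros, and each of these is simple
(`tribValuationFormula_of_period`). For `p = 83` the formula also shows that `T` has no further
integer zeros.

For the other primes, take a class `l` modulo `N` with a simple `p`-adic zero. If the conjecture
holds, this zero must be an integer `a` (`MLConjecture.exists_integer_zero`). Letting `n` tend to
`a` `p`-adically inside the class of `l`, the power `λᵢ^(n-a)` tends to the root of unity `ζᵢ` that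
is congruent to `λᵢ^(l-a)` modulo a prime above `p`, so that `Σ ζᵢ λᵢ^(a+1) (λⱼ - λₖ) = 0`
(`exists_twisted_relation`). In a complex embedding in which `λ₁` is real, comparing this relation
with its complex conjugate yields `ζ₂ ζ₃ = ζ₁²` (`IsTribRoots.twist_mul_eq`). By symmetry, the ratios
of the `ζᵢ` are powers of a cube root of unity `ω`. If `ω ≠ 1`, an identity between Tribonacci
numbers would follow that fails modulo `7` (`trib_cube_twist_ne`). If `ω = 1`, then `T(a) = 0`, so
that `a` is one of the four zeros, and `T(l + k)` is proportional to `T(a + k)` modulo `p`. It remains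
to exhibit for each `p` a class `l` with a simple `p`-adic zero for which this proportionality fails;
this is a finite computation with powers of `θ` in `(ℤ/m)[θ]`, where `θ³ = θ² + θ + 1`.
-/

/-! ### Solutions of the Tribonacci recurrence -/

/-- A two-sided sequence satisfying the Tribonacci recurrence. -/
def IsTribonacci {R : Type*} [Add R] (g : ℤ → R) : Prop :=
  ∀ n, g (n + 3) = g (n + 2) + g (n + 1) + g n

theorem isTribonacci_trib : IsTribonacci trib := trib_add_three

namespace IsTribonacci

variable {R : Type*} [CommRing R] {f g : ℤ → R}

theorem eq_zero (hg : IsTribonacci g) (h0 : g 0 = 0) (h1 : g 1 = 0) (h2 : g 2 = 0) (n : ℤ) :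
    g n = 0 := by
  suffices h : g n = 0 ∧ g (n + 1) = 0 ∧ g (n + 2) = 0 from h.1
  induction n using Int.induction_on with
  | zero => simp [h0, h1, h2]
  | succ i ih =>
    have h := hg i
    rw [ih.1, ih.2.1, ih.2.2] at h
    refine ⟨ih.2.1, ?_, ?_⟩
    · rw [show (i : ℤ) + 1 + 1 = i + 2 by ring, ih.2.2]
    · rw [show (i : ℤ) + 1 + 2 = i + 3 by ring, h]; simp
  | pred i ih =>
    have h := hg (-i - 1)
    rw [show (-i - 1 + 3 : ℤ) = -i + 2 by ring, show (-i - 1 + 2 : ℤ) = -i + 1 by ring,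
      show (-i - 1 + 1 : ℤ) = -i by ring, ih.1, ih.2.1, ih.2.2] at h
    refine ⟨by simpa using h.symm, ?_, ?_⟩
    · rw [show (-i - 1 + 1 : ℤ) = -i by ring, ih.1]
    · rw [show (-i - 1 + 2 : ℤ) = -i + 1 by ring, ih.2.1]

theorem ext (hf : IsTribonacci f) (hg : IsTribonacci g) (h0 : f 0 = g 0) (h1 : f 1 = g 1)
    (h2 : f 2 = g 2) (n : ℤ) : f n = g n := by
  refine sub_eq_zero.1 (eq_zero (g := fun n => f n - g n) (fun n => ?_) ?_ ?_ ?_ n)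
  · simp only [hf n, hg n]; ring
  · simp [h0]
  · simp [h1]
  · simp [h2]

theorem shift (hg : IsTribonacci g) (k : ℤ) : IsTribonacci fun n => g (k + n) := fun n => by
  simpa only [add_assoc] using hg (k + n)

/-- The addition formula: a solution is determined linearly by three consecutive terms, with
Tribonacci numbers as coefficients. -/
theorem add_eq (hg : IsTribonacci g) (k n : ℤ) :
    g (k + n) = trib (n - 1) * g (k + 2) + (trib (n - 2) + trib (n - 3)) * g (k + 1)
      + trib (n - 2) * g k := by
  refine ext (f := fun n => g (k + n)) (g := fun n => trib (n - 1) * g (k + 2)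
    + (trib (n - 2) + trib (n - 3)) * g (k + 1) + trib (n - 2) * g k) (hg.shift k) (fun n => ?_)
    ?_ ?_ ?_ n
  · have h (j : ℤ) : trib (n + 3 - j) = trib (n + 2 - j) + trib (n + 1 - j) + trib (n - j) := by
      have := trib_add_three (n - j)
      rwa [show n - j + 3 = n + 3 - j by ring, show n - j + 2 = n + 2 - j by ring,
        show n - j + 1 = n + 1 - j by ring] at this
    simp only [h]; push_cast; ring
  · simp [show trib (-1) = 0 from rfl, show trib (-2) = 1 from rfl, show trib (-3) = -1 from rfl]
  · simp [show trib (-1) = 0 from rfl, show trib (-2) = 1 from rfl, trib_zero]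
  · simp [show trib (-1) = 0 from rfl, trib_zero, trib_one]

/-- If `N` is a period of the Tribonacci sequence modulo `d`, it is a period of every integer
solution modulo `d`, and the difference gains a factor `c` when the solution is divisible by
`c`. -/
theorem mul_dvd_fwdDiff {g : ℤ → ℤ} (hg : IsTribonacci g) {c d N : ℤ}
    (h : ∀ k, d ∣ trib (k + N) - trib k) (hc : ∀ k, c ∣ g k) (k : ℤ) :
    c * d ∣ fwdDiff N g k := by
  have e : fwdDiff N g k = g (k + 2) * (trib (-1 + N) - trib (-1))
      + g (k + 1) * ((trib (-2 + N) - trib (-2)) + (trib (-3 + N) - trib (-3)))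
      + g k * (trib (-2 + N) - trib (-2)) := by
    rw [fwdDiff, hg.add_eq k N, show N - 1 = -1 + N by ring, show N - 2 = -2 + N by ring,
      show N - 3 = -3 + N by ring]
    simp [show trib (-1) = 0 from rfl, show trib (-2) = 1 from rfl, show trib (-3) = -1 from rfl]
    ring
  rw [e]
  exact ((mul_dvd_mul (hc _) (h _)).add (mul_dvd_mul (hc _) ((h _).add (h _)))).add
    (mul_dvd_mul (hc _) (h _))

protected theorem fwdDiff {g : ℤ → ℤ} (hg : IsTribonacci g) (N : ℤ) :
    IsTribonacci (fwdDiff N g) := fun k => by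
  have h := hg (k + N)
  simp only [fwdDiff, hg k, add_right_comm _ _ N, h]
  ring

end IsTribonacci

/-! ### The shift modulo powers of a prime -/

theorem Nat.Prime.pow_dvd_choose_mul_pow {p : ℕ} (hp : p.Prime) (h2 : p ≠ 2) {m e i : ℕ}
    (hm : p ^ e ∣ m) (hi : 2 ≤ i) : p ^ (e + 2) ∣ m.choose i * p ^ i := by
  obtain ⟨v, u, hu, rfl⟩ := Nat.exists_eq_pow_mul_and_not_dvd (n := i) (by omega) p hp.ne_one
  have hp3 : 3 ≤ p := by have := hp.two_le; omega
  have hu0 : 0 < u := Nat.pos_of_ne_zero (by rintro rfl; simp at hu)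
  have hv : v + 2 ≤ p ^ v * u := by
    rcases v with _ | v
    · simpa using hi
    · have h1 : v + 3 ≤ 3 ^ (v + 1) := by
        clear hi
        induction v with
        | zero => norm_num
        | succ v ih => rw [pow_succ]; omega
      exact h1.trans ((Nat.pow_le_pow_left hp3 _).trans (Nat.le_mul_of_pos_right _ hu0))
  set i := p ^ v * u with hidef
  have h1 : p ^ e ∣ p ^ v * (u * m.choose i) := by
    rw [← mul_assoc, ← hidef]
    rcases m with _ | m
    · rw [Nat.choose_eq_zero_of_lt (by omega)]; simp
    · obtain ⟨j, hj⟩ : ∃ j, i = j + 1 := ⟨i - 1, by omega⟩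
      rw [hj, mul_comm, ← Nat.add_one_mul_choose_eq]
      exact hm.mul_right _
  have h3 : p ^ v * p ^ (e + 2) ∣ p ^ v * (u * m.choose i * p ^ i) := by
    rw [← mul_assoc]
    refine dvd_trans ?_ (mul_dvd_mul h1 (pow_dvd_pow p hv))
    rw [← pow_add, ← pow_add]
    exact pow_dvd_pow _ (by omega)
  have h4 := Nat.dvd_of_mul_dvd_mul_left (pow_pos hp.pos v) h3
  rw [mul_assoc] at h4
  exact (Nat.Coprime.pow_left _ ((Nat.Prime.coprime_iff_not_dvd hp).2 hu)).dvd_of_dvd_mul_left h4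

theorem pow_dvd_fwdDiff_iter_trib {d N : ℤ} (h : ∀ k, d ∣ trib (k + N) - trib k) (i : ℕ) :
    IsTribonacci ((fwdDiff N)^[i] trib) ∧ ∀ k, d ^ i ∣ (fwdDiff N)^[i] trib k := by
  induction i with
  | zero => simpa using isTribonacci_trib
  | succ i ih =>
    rw [Function.iterate_succ_apply']
    exact ⟨ih.1.fwdDiff N, fun k => by rw [pow_succ]; exact ih.1.mul_dvd_fwdDiff h ih.2 k⟩

/-- If `N` is a period modulo an odd prime `p`, the shift by `m N` is given by the first two terms
of Newton's expansion, modulo `p² m`. -/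
theorem trib_shift_congr {p : ℕ} (hp : p.Prime) (h2 : p ≠ 2) {N : ℤ}
    (h : ∀ k, (p : ℤ) ∣ trib (k + N) - trib k) {m e : ℕ} (hm : p ^ e ∣ m) (k : ℤ) :
    (p : ℤ) ^ (e + 2) ∣ trib (k + m * N) - trib k - m * (trib (k + N) - trib k) := by
  rcases m with _ | m
  · simp
  have hsum := shift_eq_sum_fwdDiff_iter N trib (m + 1) k
  rw [Finset.sum_range_succ', Finset.sum_range_succ', nsmul_eq_mul] at hsum
  simp only [zero_add, Nat.choose_one_right, Nat.choose_zero_right, Function.iterate_one,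
    Function.iterate_zero, id_eq, one_smul, nsmul_eq_mul] at hsum
  rw [hsum, ← fwdDiff, add_sub_cancel_right, add_sub_cancel_right]
  refine Finset.dvd_sum fun i _ => ?_
  have h1 := Int.natCast_dvd_natCast.2 (hp.pow_dvd_choose_mul_pow h2 hm (i := i + 1 + 1) (by omega))
  refine dvd_trans ?_ (mul_dvd_mul_left _ ((pow_dvd_fwdDiff_iter_trib h _).2 k))
  exact_mod_cast h1

/-- The first difference by a period `N` modulo `p` has itself period `N` modulo `p²`. -/
theorem sq_dvd_fwdDiff_sub {p N : ℤ} (h : ∀ k, p ∣ trib (k + N) - trib k) (l : ℤ) (j : ℕ) :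
    p ^ 2 ∣ (trib (l + j * N + N) - trib (l + j * N)) - (trib (l + N) - trib l) := by
  induction j with
  | zero => simp
  | succ j ih =>
    have h3 := (isTribonacci_trib.fwdDiff N).mul_dvd_fwdDiff h h (l + j * N)
    rw [← sq] at h3
    simp only [fwdDiff] at h3
    refine (congrArg (p ^ 2 ∣ ·) ?_).mpr (h3.add ih)
    push_cast
    rw [show l + ((j : ℤ) + 1) * N = l + j * N + N by ring]
    ring

/-! ### The valuation `nuP` -/

theorem nuP_zero (p : ℕ) : nuP p 0 = ⊤ := if_pos rfl

theorem nuP_eq_of_dvd {p : ℕ} (hp : p.Prime) {x : ℤ} {e : ℕ} (h : (p : ℤ) ^ e ∣ x)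
    (h' : ¬ (p : ℤ) ^ (e + 1) ∣ x) : nuP p x = ((e : ℤ) : WithTop ℤ) := by
  have := Fact.mk hp
  have hx : x ≠ 0 := by rintro rfl; simp at h'
  rw [nuP, if_neg hx]
  rw [padicValInt_dvd_iff] at h h'
  have : padicValInt p x = e := by
    have := h.resolve_left hx
    push Not at h'
    omega
  rw [this]

theorem le_nuP_of_dvd {p : ℕ} (hp : p.Prime) {x : ℤ} {e : ℕ} (h : (p : ℤ) ^ e ∣ x) :
    ((e : ℤ) : WithTop ℤ) ≤ nuP p x := by
  have := Fact.mk hp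
  rw [nuP]
  split_ifs with hx
  · exact le_top
  · rw [padicValInt_dvd_iff] at h
    have := h.resolve_left hx
    exact_mod_cast this

theorem exists_nuP_eq_of_not_dvd {p : ℕ} (hp : p.Prime) {x : ℤ} {e : ℕ} (h : ¬ (p : ℤ) ^ e ∣ x) :
    ∃ v : ℕ, v < e ∧ nuP p x = ((v : ℤ) : WithTop ℤ) := by
  have := Fact.mk hp
  have hx : x ≠ 0 := by rintro rfl; simp at h
  refine ⟨padicValInt p x, ?_, by rw [nuP, if_neg hx]⟩
  rw [padicValInt_dvd_iff] at h
  push Not at h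
  exact h.2

theorem exists_pow_dvd_not_dvd {p : ℕ} (hp : p.Prime) {x : ℤ} (hx : x ≠ 0) :
    ∃ e : ℕ, (p : ℤ) ^ e ∣ x ∧ ¬ (p : ℤ) ^ (e + 1) ∣ x := by
  have := Fact.mk hp
  refine ⟨padicValInt p x, ?_, ?_⟩ <;> rw [padicValInt_dvd_iff] <;> simp [hx]

theorem nuP_nonneg (p : ℕ) (x : ℤ) : 0 ≤ nuP p x := by
  rw [nuP]
  split_ifs
  · exact le_top
  · exact_mod_cast Int.natCast_nonneg _

/-! ### Primes for which the formula holds -/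

/-- If `Q` is a period modulo `p`, and `z` is a zero of the Tribonacci sequence that is simple in
the sense that `p² ∤ T(z + Q)`, then the valuation of `T(z + Qm)` is `ν_p(m) + 1`. -/
theorem nuP_trib_zero_add {p : ℕ} (hp : p.Prime) (h2 : p ≠ 2) {Q z : ℤ}
    (h : ∀ k, (p : ℤ) ∣ trib (k + Q) - trib k) (hz : trib z = 0)
    (hQ : ¬ (p : ℤ) ^ 2 ∣ trib (z + Q)) (m : ℤ) :
    nuP p (trib (z + m * Q)) = nuP p m + 1 := by
  have hp' : Prime (p : ℤ) := Nat.prime_iff_prime_int.1 hp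
  rcases eq_or_ne m 0 with rfl | hm
  · simp [hz, nuP_zero]
  obtain ⟨e, he, he'⟩ := exists_pow_dvd_not_dvd hp hm
  rw [nuP_eq_of_dvd hp he he']
  suffices (p : ℤ) ^ (e + 1) ∣ trib (z + m * Q) ∧ ¬ (p : ℤ) ^ (e + 1 + 1) ∣ trib (z + m * Q) by
    rw [nuP_eq_of_dvd hp this.1 this.2]; rfl
  have key {n D : ℤ} (hn : (p : ℤ) ^ e ∣ n) (hn' : ¬ (p : ℤ) ^ (e + 1) ∣ n) (hD : (p : ℤ) ∣ D)
      (hD' : ¬ (p : ℤ) ^ 2 ∣ D) : (p : ℤ) ^ (e + 1) ∣ n * D ∧ ¬ (p : ℤ) ^ (e + 2) ∣ n * D := by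
    obtain ⟨n, rfl⟩ := hn
    obtain ⟨D, rfl⟩ := hD
    rw [pow_succ, mul_dvd_mul_iff_left (pow_ne_zero _ hp'.ne_zero)] at hn'
    rw [sq, mul_dvd_mul_iff_left hp'.ne_zero] at hD'
    rw [show (p : ℤ) ^ e * n * (p * D) = p ^ (e + 1) * (n * D) by ring]
    refine ⟨dvd_mul_right _ _, ?_⟩
    rw [pow_succ _ (e + 1), mul_dvd_mul_iff_left (pow_ne_zero _ hp'.ne_zero)]
    exact fun hd => (hp'.dvd_or_dvd hd).elim hn' hD'
  rcases m.eq_nat_or_neg with ⟨m, rfl | rfl⟩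
  · have h1 := trib_shift_congr hp h2 h (m := m) (e := e) (by exact_mod_cast he) z
    rw [hz, sub_zero, sub_zero] at h1
    have h3 := key he he' (by simpa [hz] using h z) hQ
    exact ⟨(dvd_iff_dvd_of_dvd_sub ((pow_dvd_pow _ (by omega)).trans h1)).2 h3.1,
      fun hd => h3.2 ((dvd_iff_dvd_of_dvd_sub h1).1 hd)⟩
  · rw [dvd_neg] at he he'
    -- for a negative multiple, the expansion starts at `n` and ends at the zero `z`
    set n := z + -(m : ℤ) * Q with hn
    have hnz : n + m * Q = z := by rw [hn]; ring
    have h1 := trib_shift_congr hp h2 h (m := m) (e := e) (by exact_mod_cast he) n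
    have h3 := sq_dvd_fwdDiff_sub h n m
    rw [hnz, hz] at h1 h3
    rw [sub_zero] at h3
    have h4 : ¬ (p : ℤ) ^ 2 ∣ trib (n + Q) - trib n := fun h4 =>
      hQ ((dvd_iff_dvd_of_dvd_sub h3).2 h4)
    have h5 := key he he' (h n) h4
    have h6 : (p : ℤ) ^ (e + 2) ∣ trib n - -(m * (trib (n + Q) - trib n)) := by
      rw [← dvd_neg]; exact (congrArg ((p : ℤ) ^ (e + 2) ∣ ·) (by ring)).mpr h1
    rw [dvd_iff_dvd_of_dvd_sub ((pow_dvd_pow _ (by omega)).trans h6),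
      dvd_iff_dvd_of_dvd_sub h6, dvd_neg, dvd_neg]
    exact h5

/-- A finite criterion for the valuation formula: `Q` is a period modulo `p`, the zeros of the
Tribonacci sequence are simple, and modulo `p` there are no further zeros. -/
theorem tribValuationFormula_of_period {p Q : ℕ} (hp : p.Prime) (h2 : p ≠ 2) (hQ0 : 0 < Q)
    (hpQ : ¬ p ∣ Q) (h : ∀ k, (p : ℤ) ∣ trib (k + Q) - trib k)
    (hz : ∀ z ∈ tribZeros, trib z = 0) (hzQ : ∀ z ∈ tribZeros, ¬ (p : ℤ) ^ 2 ∣ trib (z + Q))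
    (hr : ∀ r : ℕ, r < Q → (p : ℤ) ∣ trib r → ∃ z ∈ tribZeros, (r : ℤ) ≡ z [ZMOD Q]) :
    TribValuationFormula p Q := by
  have hp' : Prime (p : ℤ) := Nat.prime_iff_prime_int.1 hp
  refine fun n => ⟨fun c hc hn => ?_, fun hn => ?_⟩
  · obtain ⟨m, hm⟩ := hn.symm.dvd
    have h1 := nuP_trib_zero_add hp h2 h (hz _ hc) (hzQ _ hc) m
    rw [show -c + m * Q = n by linarith] at h1
    rw [h1]
    congr 1
    rw [show n + c = Q * m by linarith]
    rcases eq_or_ne m 0 with rfl | hm0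
    · simp
    · obtain ⟨e, he, he'⟩ := exists_pow_dvd_not_dvd hp hm0
      rw [nuP_eq_of_dvd hp he he', nuP_eq_of_dvd hp (he.mul_left _)]
      exact fun hd => he' (hp'.pow_dvd_of_dvd_mul_left _ (by exact_mod_cast hpQ) hd)
  · refine nuP_eq_of_dvd (e := 0) hp (by simp) ?_
    rw [zero_add, pow_one]
    intro hd
    have hper : Function.Periodic (fun n : ℤ => (trib n : ZMod p)) Q := fun k =>
      ((ZMod.intCast_eq_intCast_iff_dvd_sub _ _ _).2 (h k)).symm
    have hQ' : (Q : ℤ) ≠ 0 := by exact_mod_cast hQ0.ne'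
    obtain ⟨r, hr'⟩ := Int.eq_ofNat_of_zero_le (Int.emod_nonneg n hQ')
    have h4 : n = r + (n / Q) * Q := by
      rw [← hr']; linarith [Int.emod_add_mul_ediv n Q]
    have h5 : (trib (r + (n / Q) * Q) : ZMod p) = trib r := hper.int_mul (n / Q) r
    rw [← h4] at h5
    rw [← ZMod.intCast_zmod_eq_zero_iff_dvd, h5, ZMod.intCast_zmod_eq_zero_iff_dvd] at hd
    obtain ⟨z, hzm, hrz⟩ := hr r (by have := Int.emod_lt_abs n hQ'; simp at this; omega) hd
    refine hn ⟨-z, by simpa using hzm, ?_⟩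
    rw [neg_neg]
    refine Int.ModEq.trans ?_ hrz
    rw [← hr']
    exact (Int.mod_modEq n Q).symm

theorem TribValuationFormula.mlConjecture {p Q : ℕ} (h : TribValuationFormula p Q) (hQ0 : 0 < Q)
    (hpQ : ¬ p ∣ Q) : MLConjecture p := by
  refine ⟨Q, hQ0, fun i _ _ => ?_⟩
  have hQ1 : nuP p (Q : ℤ) = 0 := by
    rw [nuP, if_neg (by exact_mod_cast hQ0.ne'), padicValInt.of_nat,
      padicValNat.eq_zero_of_not_dvd hpQ]
    rfl
  by_cases hi : ∃ c : ℤ, -c ∈ tribZeros ∧ i ≡ -c [ZMOD Q]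
  · obtain ⟨c, hc, hic⟩ := hi
    refine Or.inr ⟨-c, 1, 1, one_pos, hQ1.le.trans (nuP_nonneg _ _), ?_⟩
    convert Set.finite_empty
    refine Set.eq_empty_of_forall_notMem fun n hn => hn.2 ?_
    rw [(h n).1 c hc (hn.1.trans hic), sub_neg_eq_add, add_comm]
    simp
  · refine Or.inl ⟨0, ?_⟩
    convert Set.finite_empty
    refine Set.eq_empty_of_forall_notMem fun n hn => hn.2 ((h n).2 ?_)
    rintro ⟨c, hc, hnc⟩
    exact hi ⟨c, hc, hn.1.symm.trans hnc⟩

theorem TribValuationFormula.eq_of_trib_eq_zero {p Q : ℕ} (h : TribValuationFormula p Q) {n : ℤ}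
    (hn : trib n = 0) : n ∈ tribZeros := by
  by_cases hi : ∃ c : ℤ, -c ∈ tribZeros ∧ n ≡ -c [ZMOD Q]
  · obtain ⟨c, hc, hnc⟩ := hi
    have h1 := (h n).1 c hc hnc
    rw [hn, nuP_zero, nuP] at h1
    split_ifs at h1 with h0
    · rwa [show n = -c by omega]
    · exact absurd h1.symm (WithTop.coe_ne_top (a := ((padicValInt p (n + c) : ℤ) + 1)))
  · have h1 := (h n).2 hi
    rw [hn, nuP_zero] at h1
    exact absurd h1 (by simp)

/-! ### Consequences of the conjecture -/

/-- Finite form of the uniqueness of the `p`-adic zero on a residue class modulo the period `N`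
whose derivative is a unit. -/
theorem dvd_sub_of_dvd_trib_sub {p : ℕ} (hp : p.Prime) (h2 : p ≠ 2) {N l : ℤ}
    (h : ∀ k, (p : ℤ) ∣ trib (k + N) - trib k)
    (hl : ¬ (p : ℤ) ^ 2 ∣ trib (l + N) - trib l) {e m m' : ℕ} (hm : m ≤ m')
    (hd : (p : ℤ) ^ (e + 1) ∣ trib (l + m' * N) - trib (l + m * N)) : p ^ e ∣ m' - m := by
  have hp' : Prime (p : ℤ) := Nat.prime_iff_prime_int.1 hp
  obtain ⟨d, rfl⟩ := Nat.exists_eq_add_of_le hm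
  rw [Nat.add_sub_cancel_left]
  by_contra hnd
  have hd0 : d ≠ 0 := by rintro rfl; simp at hnd
  obtain ⟨v, hv, hv'⟩ := exists_pow_dvd_not_dvd hp (x := d) (by exact_mod_cast hd0)
  have hve : v < e := by
    by_contra! hle
    exact hnd (by exact_mod_cast (pow_dvd_pow (p : ℤ) hle).trans hv)
  set k := l + m * N with hk
  have hkm : l + ((m + d : ℕ) : ℤ) * N = k + d * N := by rw [hk]; push_cast; ring
  rw [hkm] at hd
  have h1 := trib_shift_congr hp h2 h (m := d) (e := v) (by exact_mod_cast hv) k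
  have h3 : (p : ℤ) ^ (v + 2) ∣ d * (trib (k + N) - trib k) :=
    (dvd_iff_dvd_of_dvd_sub h1).1 ((pow_dvd_pow _ (by omega)).trans hd)
  obtain ⟨d', hd'⟩ := hv
  rw [hd', mul_assoc, pow_add, mul_dvd_mul_iff_left (pow_ne_zero _ hp'.ne_zero)] at h3
  have h4 : (p : ℤ) ^ 2 ∣ trib (k + N) - trib k := by
    refine hp'.pow_dvd_of_dvd_mul_left 2 (fun hpd => hv' ?_) h3
    rw [hd', pow_succ]
    exact mul_dvd_mul_left _ hpd
  exact hl ((dvd_iff_dvd_of_dvd_sub (sq_dvd_fwdDiff_sub h l m)).1 h4)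

/-- Finite form of Hensel's lemma on a residue class modulo the period `N`. -/
theorem exists_pow_dvd_trib {p : ℕ} (hp : p.Prime) (h2 : p ≠ 2) {N l : ℤ}
    (h : ∀ k, (p : ℤ) ∣ trib (k + N) - trib k) (hl0 : (p : ℤ) ∣ trib l)
    (hl : ¬ (p : ℤ) ^ 2 ∣ trib (l + N) - trib l) (e : ℕ) :
    ∃ m : ℕ, (p : ℤ) ^ (e + 1) ∣ trib (l + m * N) := by
  have hp' : Prime (p : ℤ) := Nat.prime_iff_prime_int.1 hp
  have hall (m : ℕ) : (p : ℤ) ∣ trib (l + m * N) := by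
    induction m with
    | zero => simpa using hl0
    | succ m ih =>
      have e1 : l + ((m + 1 : ℕ) : ℤ) * N = l + m * N + N := by push_cast; ring
      rw [e1]
      exact (dvd_iff_dvd_of_dvd_sub (h _)).2 ih
  choose f hf using hall
  have : NeZero (p ^ e) := ⟨pow_ne_zero _ hp.ne_zero⟩
  -- `m ↦ T(l + m N) / p` is injective, hence surjective, modulo `p ^ e`
  let F : Fin (p ^ e) → ZMod (p ^ e) := fun m => (f m : ZMod (p ^ e))
  have key {m m' : Fin (p ^ e)} (hle : m ≤ m') (hF : F m = F m') : m = m' := by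
    have h1 : (p : ℤ) ^ e ∣ f m' - f m := by
      have := (ZMod.intCast_eq_intCast_iff_dvd_sub _ _ _).1 hF
      exact_mod_cast this
    have h3 := dvd_sub_of_dvd_trib_sub hp h2 h hl (e := e) (m := m) (m' := m')
      (by exact_mod_cast hle) (by
        rw [hf, hf, ← mul_sub, pow_succ']; exact mul_dvd_mul_left _ h1)
    have h4 := Nat.eq_zero_of_dvd_of_lt h3 (by omega)
    have : (m : ℕ) ≤ m' := by exact_mod_cast hle
    exact Fin.ext (by omega)
  have hinj : Function.Injective F := fun m m' hF =>
    (le_total m m').elim (fun hle => key hle hF) fun hle => (key hle hF.symm).symm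
  have hsurj := ((Fintype.bijective_iff_injective_and_card F).2 ⟨hinj, by simp⟩).2
  obtain ⟨m, hm⟩ := hsurj 0
  refine ⟨m, ?_⟩
  rw [hf, pow_succ']
  refine mul_dvd_mul_left _ ?_
  have := (ZMod.intCast_zmod_eq_zero_iff_dvd _ _).1 hm
  exact_mod_cast this

/-- If the conjecture holds, the `p`-adic zero on a residue class modulo the period with unit
derivative is a rational integer `a`. -/
theorem MLConjecture.exists_integer_zero {p : ℕ} (hp : p.Prime) (h2 : p ≠ 2)
    (hML : MLConjecture p) {N l : ℤ} (h : ∀ k, (p : ℤ) ∣ trib (k + N) - trib k)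
    (hl0 : (p : ℤ) ∣ trib l) (hl : ¬ (p : ℤ) ^ 2 ∣ trib (l + N) - trib l) :
    ∃ a : ℤ, ∀ e : ℕ, ∃ n : ℤ, n ≡ l [ZMOD N] ∧ (p : ℤ) ^ e ∣ trib n ∧ (p : ℤ) ^ e ∣ n - a := by
  have hp' : Prime (p : ℤ) := Nat.prime_iff_prime_int.1 hp
  obtain ⟨Q, hQ0, hQ⟩ := hML
  obtain ⟨v, Q', hQ', rfl⟩ := Nat.exists_eq_pow_mul_and_not_dvd hQ0.ne' p hp.ne_one
  -- `N'` is a period that takes the part of `Q` prime to `p` into account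
  set N' : ℤ := Q' * N with hN'
  have hper (k : ℤ) : (p : ℤ) ∣ trib (k + N') - trib k := by
    have h1 := trib_shift_congr hp h2 h (m := Q') (e := 0) (by simp) k
    exact (dvd_iff_dvd_of_dvd_sub ((dvd_pow_self _ (by omega)).trans h1)).2 ((h k).mul_left _)
  have hlN' : ¬ (p : ℤ) ^ 2 ∣ trib (l + N') - trib l := by
    have h1 := trib_shift_congr hp h2 h (m := Q') (e := 0) (by simp) l
    rw [dvd_iff_dvd_of_dvd_sub h1]
    exact fun hd => hl (hp'.pow_dvd_of_dvd_mul_left 2 (by exact_mod_cast hQ') hd)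
  have hN0 : N' ≠ 0 := by
    intro h0; rw [h0] at hlN'; simp at hlN'
  choose m hm using exists_pow_dvd_trib hp h2 hper hl0 hlN'
  have hmodQ (e : ℕ) (he : v ≤ e) (t : ℕ) :
      l + ((m e + p ^ e * t : ℕ) : ℤ) * N' ≡ l + m v * N' [ZMOD ((p ^ v * Q' : ℕ) : ℤ)] := by
    have h1 : (p : ℤ) ^ v ∣ (m e : ℤ) - m v := by
      have h3 : (p : ℤ) ^ (v + 1) ∣ trib (l + m e * N') - trib (l + m v * N') :=
        ((pow_dvd_pow _ (by omega)).trans (hm e)).sub (hm v)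
      rcases le_total (m v) (m e) with hle | hle
      · have := dvd_sub_of_dvd_trib_sub hp h2 hper hlN' hle h3
        rw [← Nat.cast_sub hle]; exact_mod_cast this
      · rw [← dvd_neg, neg_sub] at h3
        have := dvd_sub_of_dvd_trib_sub hp h2 hper hlN' hle h3
        rw [← dvd_neg, neg_sub, ← Nat.cast_sub hle]; exact_mod_cast this
    refine (Int.modEq_iff_dvd.2 ?_).symm
    have h3 : (p : ℤ) ^ v ∣ (m e : ℤ) - m v + p ^ e * t :=
      h1.add ((pow_dvd_pow _ he).mul_right _)
    have h4 := mul_dvd_mul h3 (dvd_mul_right (Q' : ℤ) N)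
    refine (congrArg₂ (· ∣ ·) ?_ ?_).mpr h4
    · push_cast; ring
    · rw [hN']; push_cast; ring
  set i := (l + m v * N') % ((p ^ v * Q' : ℕ) : ℤ) with hi
  have hQ0' : (0 : ℤ) < ((p ^ v * Q' : ℕ) : ℤ) := by exact_mod_cast hQ0
  -- the class of `i` has infinitely many members at which `T` is highly divisible
  have key {S : Set ℤ} (hS : S.Finite) (e : ℕ) : ∃ n : ℤ, n ∉ S ∧
      n ≡ i [ZMOD ((p ^ v * Q' : ℕ) : ℤ)] ∧ n ≡ l [ZMOD N] ∧ (p : ℤ) ^ e ∣ trib n := by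
    let E := max e v
    have hinj : Function.Injective fun t : ℕ => l + ((m E + p ^ E * t : ℕ) : ℤ) * N' := by
      intro t t' htt
      have h1 := mul_right_cancel₀ hN0 (add_left_cancel htt)
      have h3 := add_left_cancel (Nat.cast_injective h1)
      exact Nat.eq_of_mul_eq_mul_left (pow_pos hp.pos _) h3
    obtain ⟨_, ⟨t, rfl⟩, ht⟩ := (Set.infinite_range_of_injective hinj).exists_notMem_finite hS
    refine ⟨_, ht, (hmodQ E (le_max_right _ _) t).trans (Int.mod_modEq _ _).symm, ?_, ?_⟩
    · refine (Int.modEq_iff_dvd.2 ?_).symm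
      rw [add_sub_cancel_left, hN', mul_left_comm, ← mul_assoc]
      exact dvd_mul_left _ _
    · refine (pow_dvd_pow _ (le_max_left e v)).trans ?_
      have h1 := trib_shift_congr hp h2 hper (m := p ^ E * t) (e := E) (dvd_mul_right _ _)
        (l + m E * N')
      have h3 : (p : ℤ) ^ E ∣ ((p ^ E * t : ℕ) : ℤ) *
          (trib (l + m E * N' + N') - trib (l + m E * N')) :=
        Dvd.dvd.mul_right (by push_cast; exact dvd_mul_right _ _) _
      have h4 := (dvd_iff_dvd_of_dvd_sub ((pow_dvd_pow _ (by omega)).trans h1)).2 h3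
      have h5 := (dvd_iff_dvd_of_dvd_sub h4).2 ((pow_dvd_pow _ (by omega)).trans (hm E))
      refine (congrArg (fun x => (p : ℤ) ^ E ∣ trib x) ?_).mpr h5
      push_cast; ring
  rcases hQ i (Int.emod_nonneg _ hQ0'.ne') (Int.emod_lt_of_pos _ hQ0') with
    ⟨κ, hfin⟩ | ⟨a, κ, μ, hμ, -, hfin⟩
  · obtain ⟨n, hnS, hni, -, hn⟩ := key hfin (κ + 1)
    simp only [Set.mem_ofPred_eq, not_and, not_not] at hnS
    have h1 := le_nuP_of_dvd hp hn
    rw [hnS hni] at h1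
    have h3 : ((κ + 1 : ℕ) : ℤ) ≤ (κ : ℤ) := WithTop.coe_le_coe.1 h1
    omega
  · refine ⟨a, fun e => ?_⟩
    obtain ⟨n, hnS, hni, hnl, hn⟩ := key hfin (max e (κ + μ * e).toNat)
    refine ⟨n, hnl, (pow_dvd_pow _ (le_max_left _ _)).trans hn, ?_⟩
    simp only [Set.mem_ofPred_eq, not_and, not_not] at hnS
    by_contra hna
    obtain ⟨w, hw, hw'⟩ := exists_nuP_eq_of_not_dvd hp hna
    have h1 := le_nuP_of_dvd hp ((pow_dvd_pow _ (le_max_right _ _)).trans hn)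
    rw [hnS hni, hw'] at h1
    have h3 : (((κ + μ * e).toNat : ℕ) : ℤ) ≤ κ + μ * w := by
      have h4 : (κ : WithTop ℤ) + (μ : WithTop ℤ) * ((w : ℤ) : WithTop ℤ)
        = ((κ + μ * w : ℤ) : WithTop ℤ) := by
        rw [WithTop.coe_add, WithTop.coe_mul]
      rw [h4] at h1
      exact WithTop.coe_le_coe.1 h1
    have h5 : κ + μ * e ≤ (((κ + μ * e).toNat : ℕ) : ℤ) := Int.self_le_toNat _
    have h6 : μ * w < μ * e := mul_lt_mul_of_pos_left (by exact_mod_cast hw) hμ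
    omega

/-! ### The characteristic roots -/

/-- The elements `x`, `y`, `z` are the three roots of `X³ - X² - X - 1`, expressed through their
elementary symmetric functions. -/
structure IsTribRoots {R : Type*} [CommRing R] (x y z : R) : Prop where
  sum : x + y + z = 1
  sum_mul : x * y + y * z + z * x = -1
  mul : x * y * z = 1

namespace IsTribRoots

variable {R : Type*} [CommRing R] {x y z : R}

theorem rotate (h : IsTribRoots x y z) : IsTribRoots y z x where
  sum := by linear_combination h.sum
  sum_mul := by linear_combination h.sum_mul
  mul := by linear_combination h.mul

theorem map {S : Type*} [CommRing S] (h : IsTribRoots x y z) (f : R →+* S) :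
    IsTribRoots (f x) (f y) (f z) where
  sum := by rw [← map_add, ← map_add, h.sum, map_one]
  sum_mul := by simp only [← map_mul, ← map_add, h.sum_mul, map_neg, map_one]
  mul := by rw [← map_mul, ← map_mul, h.mul, map_one]

theorem pow_three (h : IsTribRoots x y z) : x ^ 3 = x ^ 2 + x + 1 := by
  linear_combination x ^ 2 * h.sum - x * h.sum_mul + h.mul

/-- The Vandermonde product of the roots, normalized so that it is the common denominator in
Binet's formula. -/
def vandermonde (x y z : R) : R := x ^ 2 * (y - z) + y ^ 2 * (z - x) + z ^ 2 * (x - y)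

theorem vandermonde_sq (h : IsTribRoots x y z) : vandermonde x y z ^ 2 = -44 := by
  have e : vandermonde x y z ^ 2 = (x + y + z) ^ 2 * (x * y + y * z + z * x) ^ 2
      - 4 * (x * y + y * z + z * x) ^ 3 - 4 * (x + y + z) ^ 3 * (x * y * z)
      + 18 * (x + y + z) * (x * y + y * z + z * x) * (x * y * z) - 27 * (x * y * z) ^ 2 := by
    rw [vandermonde]; ring
  rw [e, h.sum, h.sum_mul, h.mul]
  norm_num

theorem derivative_eq (h : IsTribRoots x y z) :
    (x - y) * (x - z) = 3 * x ^ 2 - 2 * x - 1 := by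
  linear_combination h.sum_mul - 2 * x * h.sum

end IsTribRoots

theorem isTribonacci_units_zpow {R : Type*} [CommRing R] {u : Rˣ}
    (h : (u : R) ^ 3 = (u : R) ^ 2 + u + 1) : IsTribonacci fun n : ℤ => ((u ^ n : Rˣ) : R) := by
  intro n
  simp only [zpow_add, Units.val_mul, zpow_one]
  rw [show ((u ^ (3 : ℤ) : Rˣ) : R) = (u : R) ^ 3 from rfl,
    show ((u ^ (2 : ℤ) : Rˣ) : R) = (u : R) ^ 2 from rfl, h]
  ring

/-- Binet's formula. -/
theorem vandermonde_mul_trib {R : Type*} [CommRing R] {x y z : Rˣ}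
    (h : IsTribRoots (x : R) y z) (n : ℤ) :
    IsTribRoots.vandermonde (x : R) y z * trib n = ((x ^ (n + 1) : Rˣ) : R) * (y - z)
      + ((y ^ (n + 1) : Rˣ) : R) * (z - x) + ((z ^ (n + 1) : Rˣ) : R) * (x - y) := by
  have hx := isTribonacci_units_zpow h.pow_three
  have hy := isTribonacci_units_zpow h.rotate.pow_three
  have hz := isTribonacci_units_zpow h.rotate.rotate.pow_three
  refine IsTribonacci.ext (f := fun n => IsTribRoots.vandermonde (x : R) y z * trib n)
    (g := fun n => ((x ^ (n + 1) : Rˣ) : R) * (y - z)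
      + ((y ^ (n + 1) : Rˣ) : R) * (z - x) + ((z ^ (n + 1) : Rˣ) : R) * (x - y))
    (fun n => ?_) (fun n => ?_) ?_ ?_ ?_ n
  · simp only [trib_add_three]; push_cast; ring
  · have hx' := hx (n + 1)
    have hy' := hy (n + 1)
    have hz' := hz (n + 1)
    simp only [add_right_comm n _ (1 : ℤ)] at hx' hy' hz' ⊢
    rw [hx', hy', hz']; ring
  · simp only [trib_zero, Int.cast_zero, mul_zero, zero_add, zpow_one]; ring
  · simp only [trib_one, IsTribRoots.vandermonde]
    rw [show (1 + 1 : ℤ) = ((2 : ℕ) : ℤ) by norm_num]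
    simp only [zpow_natCast, Units.val_pow_eq_pow_val]; push_cast; ring
  · simp only [trib_two, IsTribRoots.vandermonde]
    rw [show (2 + 1 : ℤ) = ((3 : ℕ) : ℤ) by norm_num]
    simp only [zpow_natCast, Units.val_pow_eq_pow_val]
    linear_combination (-((x : R) ^ 2 * (y - z) + (y : R) ^ 2 * (z - x) + (z : R) ^ 2 * (x - y)))
      * h.sum

/-! ### Relations twisted by roots of unity -/

theorem Complex.conj_eq_inv_of_pow_eq_one {N : ℕ} (hN : N ≠ 0) {ζ : ℂ} (h : ζ ^ N = 1) :
    (starRingEnd ℂ) ζ = ζ⁻¹ := by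
  rw [Complex.inv_def, Complex.normSq_eq_norm_sq, Complex.norm_eq_one_of_pow_eq_one h hN]
  simp

/-- The two roots other than a real one are complex conjugate, since the discriminant of
`X³ - X² - X - 1` is negative. -/
theorem IsTribRoots.conj_eq {x y z : ℂ} (h : IsTribRoots x y z)
    (hx : (starRingEnd ℂ) x = x) : (starRingEnd ℂ) y = z := by
  have h1 := congrArg (starRingEnd ℂ) h.rotate.pow_three
  simp only [map_add, map_pow, map_one] at h1
  set w := (starRingEnd ℂ) y with hw
  have h3 : (w - x) * ((w - y) * (w - z)) = 0 := by
    linear_combination h1 - w ^ 2 * h.sum + w * h.sum_mul - h.mul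
  have hdisc : ((x - y) * (y - z) * (z - x)) ^ 2 = -44 := by
    rw [← h.vandermonde_sq, vandermonde]; ring
  rcases mul_eq_zero.1 h3 with h4 | h4
  · -- then `y = x`, contradicting separability
    have h5 : y = x := by
      rw [← Complex.conj_conj y, ← hw, sub_eq_zero.1 h4, hx]
    rw [h5] at hdisc; norm_num at hdisc
  rcases mul_eq_zero.1 h4 with h4 | h4
  · -- then all roots are real, and the discriminant would be nonnegative
    exfalso
    have hz : (starRingEnd ℂ) z = z := by
      have := congrArg (starRingEnd ℂ) h.sum
      simp only [map_add, map_one, hx, ← hw, sub_eq_zero.1 h4] at this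
      linear_combination this - h.sum
    have hr : (starRingEnd ℂ) ((x - y) * (y - z) * (z - x)) = (x - y) * (y - z) * (z - x) := by
      simp only [map_mul, map_sub, hx, ← hw, sub_eq_zero.1 h4, hz]
    obtain ⟨r, hr⟩ := Complex.conj_eq_iff_real.1 hr
    rw [hr] at hdisc
    have : r ^ 2 = -44 := by exact_mod_cast hdisc
    nlinarith [sq_nonneg r]
  · exact sub_eq_zero.1 h4

/-- A relation between the three terms of Binet's formula twisted by roots of unity, for the
embedding in which the first root is real: comparison with the complex conjugate relation
determines the product of the twists of the two complex terms. -/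
theorem IsTribRoots.twist_mul_eq_of_real {x y z : ℂ} (h : IsTribRoots x y z)
    (hx : (starRingEnd ℂ) x = x) {N : ℕ} (hN : N ≠ 0) {ζ₁ ζ₂ ζ₃ : ℂ}
    (h1 : ζ₁ ^ N = 1) (h2 : ζ₂ ^ N = 1) (h3 : ζ₃ ^ N = 1) (n : ℤ)
    (hrel : ζ₁ * (x ^ n * (y - z)) + ζ₂ * (y ^ n * (z - x)) + ζ₃ * (z ^ n * (x - y)) = 0) :
    ζ₂ * ζ₃ = ζ₁ ^ 2 := by
  have hy := h.conj_eq hx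
  have hz : (starRingEnd ℂ) z = y := by rw [← hy, Complex.conj_conj]
  have hne {ζ : ℂ} (hζ : ζ ^ N = 1) : ζ ≠ 0 := by rintro rfl; simp [hN] at hζ
  have hc := congrArg (starRingEnd ℂ) hrel
  simp only [map_add, map_mul, map_sub, map_zpow₀, hx, hy, hz, map_zero,
    Complex.conj_eq_inv_of_pow_eq_one hN h1, Complex.conj_eq_inv_of_pow_eq_one hN h2,
    Complex.conj_eq_inv_of_pow_eq_one hN h3] at hc
  have hn1 := hne h1
  have hn2 := hne h2
  have hn3 := hne h3
  field_simp at hc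
  by_contra hcon
  have hprod : (ζ₂ * ζ₃ - ζ₁ ^ 2) * (ζ₂ * (y ^ n * (z - x)) + ζ₃ * (z ^ n * (x - y))) = 0 := by
    linear_combination ζ₂ * ζ₃ * hrel + ζ₁ * hc
  rcases mul_eq_zero.1 hprod with h4 | h4
  · exact hcon (sub_eq_zero.1 h4)
  -- otherwise the real term of the relation would vanish
  have h5 : ζ₁ * (x ^ n * (y - z)) = 0 := by linear_combination hrel - h4
  have hx0 : x ≠ 0 := by rintro rfl; simpa using h.mul
  have hyz : y - z ≠ 0 := by
    intro h0
    have := h.vandermonde_sq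
    rw [vandermonde, sub_eq_zero.1 h0] at this
    ring_nf at this
    norm_num at this
  exact mul_ne_zero hn1 (mul_ne_zero (zpow_ne_zero n hx0) hyz) h5

open Polynomial in
/-- Every root of `X³ - X² - X - 1` in `AlgebraicClosure ℚ` becomes real under some complex
embedding, because the polynomial is irreducible and has a real root. -/
theorem exists_embedding_real {x : AlgebraicClosure ℚ} (hx : x ^ 3 = x ^ 2 + x + 1) :
    ∃ φ : AlgebraicClosure ℚ →+* ℂ, (starRingEnd ℂ) (φ x) = φ x := by
  obtain ⟨r, hr⟩ : ∃ r : ℝ, r ^ 3 - r ^ 2 - r - 1 = 0 := by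
    have hc : ContinuousOn (fun r : ℝ => r ^ 3 - r ^ 2 - r - 1) (Set.Icc 0 2) := by fun_prop
    obtain ⟨r, -, hr⟩ := intermediate_value_Icc (by norm_num) hc
      (show (0 : ℝ) ∈ Set.Icc _ _ by norm_num)
    exact ⟨r, hr⟩
  let f : ℚ[X] := X ^ 3 - X ^ 2 - X - 1
  have hdeg : f.natDegree = 3 := by simp only [f]; compute_degree!
  have hmonic : f.Monic := by simp only [f]; monicity!
  have hirr : Irreducible f := by
    refine irreducible_of_degree_le_three_of_not_isRoot (by rw [hdeg]; decide) fun q hq => ?_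
    let g : ℤ[X] := X ^ 3 - X ^ 2 - X - 1
    have hg : g.Monic := by simp only [g]; monicity!
    have hq' : q ^ 3 - q ^ 2 - q - 1 = 0 := by simpa [f, IsRoot] using hq
    obtain ⟨m, hm⟩ := isInteger_of_is_root_of_monic (A := ℤ) (K := ℚ) hg (r := q)
      (by simpa [g] using hq')
    rw [← hm] at hq'
    have hm' : m ^ 3 - m ^ 2 - m - 1 = 0 := by
      simp only [algebraMap_int_eq, eq_intCast] at hq'
      exact_mod_cast hq'
    have hu : m * (m ^ 2 - m - 1) = 1 := by linear_combination hm'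
    rcases Int.isUnit_iff.1 (IsUnit.of_mul_eq_one _ hu) with rfl | rfl <;> norm_num at hm'
  have hmin : minpoly ℚ x = f := by
    refine (minpoly.eq_of_irreducible_of_monic hirr ?_ hmonic).symm
    simp only [f, map_sub, map_pow, aeval_X, map_one, hx]; ring
  have : Algebra.IsAlgebraic ℚ (AlgebraicClosure ℚ) := AlgebraicClosure.isAlgebraic ℚ
  have hmem : (r : ℂ) ∈ (minpoly ℚ x).rootSet ℂ := by
    rw [hmin, mem_rootSet]
    refine ⟨hmonic.ne_zero, ?_⟩
    simp only [f, map_sub, map_pow, aeval_X, map_one]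
    exact_mod_cast hr
  rw [← Algebra.IsAlgebraic.range_eval_eq_rootSet_minpoly] at hmem
  obtain ⟨φ, hφ⟩ := hmem
  refine ⟨φ.toRingHom, ?_⟩
  rw [show φ.toRingHom x = r from hφ, Complex.conj_ofReal]

theorem IsTribRoots.twist_mul_eq {x y z : AlgebraicClosure ℚ} (h : IsTribRoots x y z)
    {N : ℕ} (hN : N ≠ 0) {ζ₁ ζ₂ ζ₃ : AlgebraicClosure ℚ}
    (h1 : ζ₁ ^ N = 1) (h2 : ζ₂ ^ N = 1) (h3 : ζ₃ ^ N = 1) (n : ℤ)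
    (hrel : ζ₁ * (x ^ n * (y - z)) + ζ₂ * (y ^ n * (z - x)) + ζ₃ * (z ^ n * (x - y)) = 0) :
    ζ₂ * ζ₃ = ζ₁ ^ 2 := by
  obtain ⟨φ, hφ⟩ := exists_embedding_real h.pow_three
  refine φ.injective ?_
  rw [map_mul, map_pow]
  have hp {ζ : AlgebraicClosure ℚ} (hζ : ζ ^ N = 1) : φ ζ ^ N = 1 := by rw [← map_pow, hζ, map_one]
  refine (h.map φ).twist_mul_eq_of_real hφ hN (hp h1) (hp h2) (hp h3) n ?_
  have := congrArg φ hrel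
  simpa only [map_add, map_mul, map_sub, map_zpow₀, map_zero] using this

/-- The relation twisted by the three cube roots of unity amounts to an identity between
Tribonacci numbers. -/
theorem IsTribRoots.trib_identity_of_cube_twist {K : Type*} [Field K] [CharZero K] {x y z : K}
    (h : IsTribRoots x y z) {ω : K} (hω : ω ^ 2 + ω + 1 = 0) {a : ℤ}
    (hrel : x ^ (a + 1) * (y - z) + ω * (y ^ (a + 1) * (z - x))
      + ω ^ 2 * (z ^ (a + 1) * (x - y)) = 0) :
    44 * trib a ^ 2
      = 3 * (16 * trib (-a - 2) + 14 * (trib (-a - 3) + trib (-a - 4)) + 4 * trib (-a - 3)) := by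
  have hunit {x y z : K} (h : IsTribRoots x y z) : x ≠ 0 := by rintro rfl; simpa using h.mul
  let ux := Units.mk0 x (hunit h)
  let uy := Units.mk0 y (hunit h.rotate)
  let uz := Units.mk0 z (hunit h.rotate.rotate)
  have hb := vandermonde_mul_trib (x := ux) (y := uy) (z := uz) h a
  have hV := h.vandermonde_sq
  simp only [ux, uy, uz, Units.val_zpow_eq_zpow_val, Units.val_mk0] at hb
  -- products of two terms of Binet's formula
  have hpair {x y z : K} (h : IsTribRoots x y z) :
      (x ^ (a + 1) * (y - z)) * (y ^ (a + 1) * (z - x))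
        = -(z ^ (-a - 1) * (3 * z ^ 2 - 2 * z - 1)) := by
    rw [← h.rotate.rotate.derivative_eq]
    have h1 : x ^ (a + 1) * y ^ (a + 1) = z ^ (-a - 1) := by
      rw [← mul_zpow, eq_inv_of_mul_eq_one_left h.mul, inv_zpow', neg_add']
    rw [← h1]; ring
  -- the power sums with weight `f'(x)` form a solution of the recurrence
  let H : ℤ → K := fun m => x ^ m * (3 * x ^ 2 - 2 * x - 1) + y ^ m * (3 * y ^ 2 - 2 * y - 1)
    + z ^ m * (3 * z ^ 2 - 2 * z - 1)
  have hzp {x y z : K} (h : IsTribRoots x y z) (m : ℤ) :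
      x ^ (m + 3) = x ^ (m + 2) + x ^ (m + 1) + x ^ m :=
    (by simpa using
      isTribonacci_units_zpow (u := Units.mk0 x (hunit h)) h.pow_three m)
  have hH : IsTribonacci H := fun m => by
    simp only [H, hzp h m, hzp h.rotate m, hzp h.rotate.rotate m]; ring
  have s2 : x ^ 2 + y ^ 2 + z ^ 2 = 3 := by
    linear_combination (x + y + z + 1) * h.sum - 2 * h.sum_mul
  have c1 := h.pow_three
  have c2 := h.rotate.pow_three
  have c3 := h.rotate.rotate.pow_three
  have H0 : H 0 = 4 := by
    simp only [H, zpow_zero]; linear_combination 3 * s2 - 2 * h.sum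
  have H1 : H 1 = 14 := by
    simp only [H, zpow_one]; linear_combination 3 * c1 + 3 * c2 + 3 * c3 + s2 + 2 * h.sum
  have H2 : H 2 = 16 := by
    simp only [H]
    rw [show (2 : ℤ) = ((2 : ℕ) : ℤ) by norm_num]
    simp only [zpow_natCast]
    linear_combination (3 * x + 1) * c1 + (3 * y + 1) * c2 + (3 * z + 1) * c3
      + 3 * s2 + 4 * h.sum
  have hval := hH.add_eq 0 (-a - 1)
  rw [zero_add, zero_add, zero_add, H0, H1, H2, show -a - 1 - 1 = -a - 2 by ring,
    show -a - 1 - 2 = -a - 3 by ring, show -a - 1 - 3 = -a - 4 by ring] at hval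
  have hval' : H (-a - 1) = x ^ (-a - 1) * (3 * x ^ 2 - 2 * x - 1)
    + y ^ (-a - 1) * (3 * y ^ 2 - 2 * y - 1) + z ^ (-a - 1) * (3 * z ^ 2 - 2 * z - 1) := rfl
  have p1 := hpair h
  have p2 := hpair h.rotate
  have p3 := hpair h.rotate.rotate
  set X := x ^ (a + 1) * (y - z)
  set Y := y ^ (a + 1) * (z - x)
  set Z := z ^ (a + 1) * (x - y)
  -- the norm form `X² + Y² + Z² - XY - YZ - ZX` has the left-hand side of `hrel` as a factor
  have hsq : (X + Y + Z) ^ 2 = 3 * (X * Y + Y * Z + Z * X) := by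
    linear_combination (X + ω ^ 2 * Y + ω * Z) * hrel
      - ((ω - 1) * (Y ^ 2 + Z ^ 2 + ω * Y * Z) + X * Y + X * Z + Y * Z) * hω
  rw [← hb, mul_pow, hV, p1, p2, p3] at hsq
  have hfin : (44 : K) * (trib a : K) ^ 2 = 3 * (16 * trib (-a - 2)
      + 14 * (trib (-a - 3) + trib (-a - 4)) + 4 * trib (-a - 3)) := by
    linear_combination -hsq + 3 * hval - 3 * hval'
  exact_mod_cast hfin

/-! ### Integer zeros and roots of unity -/

theorem Ideal.pow_prime_pow_sub_mem {O : Type*} [CommRing O] {I : Ideal O} {p : ℕ}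
    (hp : (p : O) ∈ I) {x y : O} (h : x - y ∈ I) (k : ℕ) : x ^ p ^ k - y ^ p ^ k ∈ I ^ (k + 1) := by
  induction k with
  | zero => simpa using h
  | succ k ih =>
    rw [pow_succ p k, pow_mul, pow_mul, ← geom_sum₂_mul, pow_succ' I]
    refine Ideal.mul_mem_mul ?_ ih
    have h1 : Ideal.Quotient.mk I (x ^ p ^ k) = Ideal.Quotient.mk I (y ^ p ^ k) := by
      rw [map_pow, map_pow, Ideal.Quotient.eq.2 h]
    rw [← Ideal.Quotient.eq_zero_iff_mem, RingHom.map_geom_sum₂, h1, geom_sum₂_self,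
      ← map_natCast (Ideal.Quotient.mk I), Ideal.Quotient.eq_zero_iff_mem.2 hp, zero_mul]

/-- Let `P` be a prime above `p`, and let `N` be a period modulo `p`. A power `x ^ (l - a)` of a
characteristic root is congruent modulo `P` to an `N`-th root of unity `ζ`, its Teichmüller
representative, and `x ^ (n - a)` is close to `ζ` when `n ≡ l` modulo `N` and `n` is `p`-adically
close to `a`. -/
theorem exists_rootOfUnity_approx {O : Type*} [CommRing O] [IsDomain O] {P : Ideal O}
    [hP : P.IsPrime] {p N : ℕ} (hp : (p : O) ∈ P) (hN : 0 < N) {η : O} (hη : IsPrimitiveRoot η N)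
    (hper : ∀ k, (p : ℤ) ∣ trib (k + N) - trib k) {x : Oˣ}
    (hx : (x : O) ^ 3 = (x : O) ^ 2 + x + 1) (a l : ℤ) :
    ∃ ζ : O, ζ ^ N = 1 ∧ ((x ^ (l - a) : Oˣ) : O) - ζ ∈ P ∧
      ∀ (n : ℤ) (e : ℕ), n ≡ l [ZMOD N] → (p : ℤ) ^ e ∣ n - a → p ^ e ≡ 1 [MOD N] →
        ((x ^ (n - a) : Oˣ) : O) - ζ ∈ P ^ (e + 1) := by
  let π : Oˣ →* (O ⧸ P)ˣ := Units.map (Ideal.Quotient.mk P : O →* O ⧸ P)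
  have hπ {u v : Oˣ} : π u = π v ↔ (u : O) - v ∈ P := by
    rw [Units.ext_iff]; exact Ideal.Quotient.eq
  have hg := isTribonacci_units_zpow hx
  -- the period of the Tribonacci sequence modulo `p` is an exponent of `x` modulo `P`
  have hxN : π x ^ N = 1 := by
    rw [← map_pow, ← map_one π, hπ]
    have e1 := hg.add_eq 0 N
    have e2 := hg.add_eq 0 0
    simp only [zero_add] at e1 e2
    rw [zpow_natCast, zpow_zero] at e1
    rw [zpow_zero] at e2
    have hd (j : ℤ) : ((trib (N - j) - trib (0 - j) : ℤ) : O) ∈ P := by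
      obtain ⟨c, hc⟩ := hper (0 - j)
      rw [show (N : ℤ) - j = 0 - j + N by ring, hc]
      push_cast
      exact P.mul_mem_right _ hp
    have e3 : ((x ^ N : Oˣ) : O) - ((1 : Oˣ) : O)
        = ((trib (N - 1) - trib (0 - 1) : ℤ) : O) * ((x ^ (2 : ℤ) : Oˣ) : O)
          + (((trib (N - 2) - trib (0 - 2) : ℤ) : O) + ((trib (N - 3) - trib (0 - 3) : ℤ) : O))
            * ((x ^ (1 : ℤ) : Oˣ) : O)
          + ((trib (N - 2) - trib (0 - 2) : ℤ) : O) * ((1 : Oˣ) : O) := by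
      simp only [Int.cast_sub]; linear_combination e1 - e2
    rw [e3]
    exact P.add_mem (P.add_mem (P.mul_mem_right _ (hd 1))
      (P.mul_mem_right _ (P.add_mem (hd 2) (hd 3)))) (P.mul_mem_right _ (hd 2))
  have hmod {i j : ℤ} (hij : i ≡ j [ZMOD N]) : π (x ^ i) = π (x ^ j) := by
    obtain ⟨c, hc⟩ := hij.dvd
    rw [show j = i + N * c by linarith, zpow_add, zpow_mul, map_mul, map_zpow π (x ^ (N : ℤ)),
      zpow_natCast, map_pow, hxN, one_zpow, mul_one]
  obtain ⟨ζ, hζ, hζP⟩ : ∃ ζ : O, ζ ^ N = 1 ∧ ((x ^ (l - a) : Oˣ) : O) - ζ ∈ P := by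
    have h1 : ((x ^ (l - a) : Oˣ) : O) ^ N - 1 ^ N ∈ P := by
      rw [one_pow, ← Units.val_pow_eq_pow_val, ← Units.val_one, ← hπ, map_pow, map_zpow,
        ← zpow_natCast, zpow_comm, zpow_natCast, hxN, one_zpow, map_one]
    rw [hη.pow_sub_pow_eq_prod_sub_mul _ _ hN, hP.prod_mem_iff] at h1
    obtain ⟨ζ, hζ, h1⟩ := h1
    exact ⟨ζ, (Polynomial.mem_nthRootsFinset hN 1).1 hζ, by simpa using h1⟩
  refine ⟨ζ, hζ, hζP, fun n e hn he hpe => ?_⟩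
  obtain ⟨t, ht⟩ := he
  have hpe' : (p : ℤ) ^ e ≡ 1 [ZMOD N] := by exact_mod_cast (Int.natCast_modEq_iff.2 hpe)
  have htl : t ≡ l - a [ZMOD N] := by
    have h1 : (p : ℤ) ^ e * t ≡ 1 * t [ZMOD N] := hpe'.mul_right t
    rw [one_mul, ← ht] at h1
    exact h1.symm.trans (hn.sub_right a)
  have h1 : ((x ^ t : Oˣ) : O) - ζ ∈ P := by
    have h3 := hπ.1 (hmod htl)
    simpa using P.add_mem h3 hζP
  have h3 := Ideal.pow_prime_pow_sub_mem hp h1 e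
  have h4 : ζ ^ p ^ e = 1 * ζ := by
    rcases Nat.eq_zero_or_pos (p ^ e) with h0 | h0
    · rw [h0] at hpe
      have : N = 1 := by
        have := (Nat.modEq_iff_dvd' (Nat.zero_le _)).1 hpe
        simpa using this
      rw [this, pow_one] at hζ
      simp [hζ]
    · obtain ⟨c, hc⟩ := (Nat.modEq_iff_dvd' h0).1 hpe.symm
      rw [show p ^ e = N * c + 1 by omega, pow_succ, pow_mul, hζ, one_pow]
  rw [h4, one_mul, ← Units.val_pow_eq_pow_val, ← zpow_natCast, ← zpow_mul] at h3
  rw [ht, mul_comm]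
  exact_mod_cast h3

/-- If the `p`-adic zero on the class of `l` modulo `N` is an integer `a`, then the relation
`T(a) = 0` holds after twisting the terms of Binet's formula by roots of unity. -/
theorem exists_twisted_relation {O : Type*} [CommRing O] [IsDomain O] [IsNoetherianRing O]
    {P : Ideal O} [hP : P.IsPrime] {p N : ℕ} (hp : (p : O) ∈ P) (hN : 0 < N)
    (hpN : p.Coprime N) {η : O} (hη : IsPrimitiveRoot η N)
    (hper : ∀ k, (p : ℤ) ∣ trib (k + N) - trib k) {x y z : Oˣ} (h : IsTribRoots (x : O) y z)
    {a l : ℤ} (ha : ∀ e : ℕ, ∃ n : ℤ, n ≡ l [ZMOD N] ∧ (p : ℤ) ^ e ∣ trib n ∧ (p : ℤ) ^ e ∣ n - a) :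
    ∃ ζ₁ ζ₂ ζ₃ : O, (ζ₁ ^ N = 1 ∧ ζ₂ ^ N = 1 ∧ ζ₃ ^ N = 1) ∧
      (((x ^ (l - a) : Oˣ) : O) - ζ₁ ∈ P ∧ ((y ^ (l - a) : Oˣ) : O) - ζ₂ ∈ P ∧
        ((z ^ (l - a) : Oˣ) : O) - ζ₃ ∈ P) ∧
      ζ₁ * (((x ^ (a + 1) : Oˣ) : O) * (y - z)) + ζ₂ * (((y ^ (a + 1) : Oˣ) : O) * (z - x))
        + ζ₃ * (((z ^ (a + 1) : Oˣ) : O) * (x - y)) = 0 := by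
  obtain ⟨ζ₁, h1, h1', H1⟩ := exists_rootOfUnity_approx hp hN hη hper h.pow_three a l
  obtain ⟨ζ₂, h2, h2', H2⟩ := exists_rootOfUnity_approx hp hN hη hper h.rotate.pow_three a l
  obtain ⟨ζ₃, h3, h3', H3⟩ := exists_rootOfUnity_approx hp hN hη hper h.rotate.rotate.pow_three a l
  refine ⟨ζ₁, ζ₂, ζ₃, ⟨h1, h2, h3⟩, ⟨h1', h2', h3'⟩, ?_⟩
  -- by Krull's intersection theorem it suffices to work modulo every power of `P`
  rw [← Ideal.mem_bot, ← Ideal.iInf_pow_eq_bot_of_isDomain P hP.ne_top, Ideal.mem_iInf]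
  intro j
  have hφ : 0 < N.totient := Nat.totient_pos.2 hN
  set e := N.totient * j with he
  have hpe : p ^ e ≡ 1 [MOD N] := by
    have := (Nat.ModEq.pow_totient hpN).pow j
    rwa [← pow_mul, one_pow] at this
  have hje : j ≤ e := Nat.le_mul_of_pos_left j hφ
  obtain ⟨n, hn, hT, hna⟩ := ha e
  have hle : P ^ (e + 1) ≤ P ^ j := Ideal.pow_le_pow_right (by omega)
  have k1 := hle (H1 n e hn hna hpe)
  have k2 := hle (H2 n e hn hna hpe)
  have k3 := hle (H3 n e hn hna hpe)
  have hTP : (trib n : O) ∈ P ^ j := by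
    obtain ⟨c, hc⟩ := hT
    rw [hc]
    push_cast
    exact Ideal.mul_mem_right _ _ (Ideal.pow_le_pow_right hje (Ideal.pow_mem_pow hp e))
  have hb := vandermonde_mul_trib h n
  have hsplit (u : Oˣ) : ((u ^ (n + 1) : Oˣ) : O)
      = ((u ^ (n - a) : Oˣ) : O) * ((u ^ (a + 1) : Oˣ) : O) := by
    rw [← Units.val_mul, ← zpow_add]; ring_nf
  rw [hsplit, hsplit, hsplit] at hb
  have hfin := (P ^ j).sub_mem
    ((P ^ j).mul_mem_left (IsTribRoots.vandermonde (x : O) y z) hTP)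
    ((P ^ j).add_mem ((P ^ j).add_mem
      ((P ^ j).mul_mem_right (((x ^ (a + 1) : Oˣ) : O) * (y - z)) k1)
      ((P ^ j).mul_mem_right (((y ^ (a + 1) : Oˣ) : O) * (z - x)) k2))
      ((P ^ j).mul_mem_right (((z ^ (a + 1) : Oˣ) : O) * (x - y)) k3))
  convert hfin using 1
  rw [hb]; ring

theorem exists_isTribRoots (K : Type*) [Field K] [IsAlgClosed K] :
    ∃ x y z : K, IsTribRoots x y z := by
  let c : Cubic K := ⟨1, -1, -1, -1⟩
  have ha : c.a ≠ 0 := one_ne_zero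
  obtain ⟨x, y, z, h3⟩ := (Cubic.splits_iff_roots_eq_three (φ := RingHom.id K) ha).1
    (IsAlgClosed.splits _)
  have hb := Cubic.b_eq_three_roots ha h3
  have hc := Cubic.c_eq_three_roots ha h3
  have hd := Cubic.d_eq_three_roots ha h3
  simp only [c, RingHom.id_apply] at hb hc hd
  exact ⟨x, y, z, by linear_combination hb, by linear_combination -hc, by linear_combination hd⟩

/-- A criterion for the failure of the conjecture: the class of `l` modulo a period `N` carries a
`p`-adic zero with unit derivative, and modulo `p` the sequence starting at `l` is not proportional
to the sequence starting at an integer zero. -/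
theorem not_mlConjecture_of_zero {p : ℕ} (hp : p.Prime) (hp44 : ¬ p ∣ 44) {N : ℕ} (hN : 0 < N)
    (hpN : p.Coprime N) (hper : ∀ k, (p : ℤ) ∣ trib (k + N) - trib k) {l : ℤ}
    (hl0 : (p : ℤ) ∣ trib l) (hl : ¬ (p : ℤ) ^ 2 ∣ trib (l + N) - trib l)
    (hzeros : ∀ n, trib n = 0 → n ∈ tribZeros)
    (hlz : ∀ z ∈ tribZeros, ¬ (p : ℤ) ∣ trib (l + 1) * trib (z + 2) - trib (l + 2) * trib (z + 1))
    (hcube : ∀ a, 44 * trib a ^ 2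
      ≠ 3 * (16 * trib (-a - 2) + 14 * (trib (-a - 3) + trib (-a - 4)) + 4 * trib (-a - 3))) :
    ¬ MLConjecture p := by
  intro hML
  have h2 : p ≠ 2 := by rintro rfl; norm_num at hp44
  obtain ⟨a, ha⟩ := hML.exists_integer_zero hp h2 hper hl0 hl
  let K := AlgebraicClosure ℚ
  obtain ⟨x, y, z, hxyz⟩ := exists_isTribRoots K
  have : NeZero (N : K) := ⟨by exact_mod_cast hN.ne'⟩
  obtain ⟨η, hη⟩ := HasEnoughRootsOfUnity.exists_primitiveRoot K N
  -- the ring generated by the characteristic roots and the `N`-th roots of unity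
  let O : Subalgebra ℤ K := Algebra.adjoin ℤ {x, y, z, η}
  have hint : ∀ u ∈ ({x, y, z, η} : Set K), IsIntegral ℤ u := by
    have hroot {u : K} (hu : u ^ 3 = u ^ 2 + u + 1) : IsIntegral ℤ u := by
      refine ⟨Polynomial.X ^ 3 - Polynomial.X ^ 2 - Polynomial.X - 1, by monicity!, ?_⟩
      simp [hu]; ring
    rintro u (rfl | rfl | rfl | rfl)
    · exact hroot hxyz.pow_three
    · exact hroot hxyz.rotate.pow_three
    · exact hroot hxyz.rotate.rotate.pow_three
    · exact hη.isIntegral hN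
  have : Algebra.IsIntegral ℤ O := Algebra.IsIntegral.adjoin hint
  have : IsNoetherianRing O := by
    refine Algebra.FiniteType.isNoetherianRing ℤ O (h := ?_)
    exact (Subalgebra.fg_iff_finiteType _).1 (Subalgebra.fg_def.2 ⟨_, Set.toFinite _, rfl⟩)
  have hmem {u : K} (hu : u ∈ ({x, y, z, η} : Set K)) : u ∈ O := Algebra.subset_adjoin hu
  let x' : O := ⟨x, hmem (by simp)⟩
  let y' : O := ⟨y, hmem (by simp)⟩
  let z' : O := ⟨z, hmem (by simp)⟩
  let η' : O := ⟨η, hmem (by simp)⟩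
  have hη' : IsPrimitiveRoot η' N :=
    IsPrimitiveRoot.of_map_of_injective (f := O.val) hη Subtype.val_injective
  have hO : IsTribRoots x' y' z' :=
    ⟨Subtype.ext hxyz.sum, Subtype.ext hxyz.sum_mul, Subtype.ext hxyz.mul⟩
  let X : Oˣ := .mkOfMulEqOne x' (y' * z') (by rw [← mul_assoc, hO.mul])
  let Y : Oˣ := .mkOfMulEqOne y' (z' * x') (by rw [← mul_assoc, hO.rotate.mul])
  let Z : Oˣ := .mkOfMulEqOne z' (x' * y') (by rw [← mul_assoc, hO.rotate.rotate.mul])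
  have hXYZ : IsTribRoots (X : O) Y Z := hO
  have hp' : Prime (p : ℤ) := Nat.prime_iff_prime_int.1 hp
  have : (Ideal.span {(p : ℤ)}).IsPrime := (Ideal.span_singleton_prime hp'.ne_zero).2 hp'
  obtain ⟨P, hP, hPp⟩ := Ideal.exists_ideal_over_prime_of_isIntegral_of_isDomain (S := O)
    (Ideal.span {(p : ℤ)}) (by
      rw [(RingHom.injective_iff_ker_eq_bot _).1 (FaithfulSMul.algebraMap_injective ℤ O)]
      exact bot_le)
  have hPmem (c : ℤ) : (c : O) ∈ P ↔ (p : ℤ) ∣ c := by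
    rw [← Ideal.mem_span_singleton, ← hPp, Ideal.mem_comap]; rfl
  obtain ⟨ζ₁, ζ₂, ζ₃, ⟨h1, h2, h3⟩, ⟨h1', h2', h3'⟩, hrel⟩ := exists_twisted_relation (P := P)
    (by exact_mod_cast (hPmem p).2 dvd_rfl) hN hpN hη' hper hXYZ ha
  have hval (U : Oˣ) (n : ℤ) : (((U ^ n : Oˣ) : O) : K) = ((U : O) : K) ^ n := by
    have := congrArg Units.val (map_zpow (Units.map (O.val : O →* K)) U n)
    rwa [Units.val_zpow_eq_zpow_val] at this
  have hrelK : (ζ₁ : K) * (x ^ (a + 1) * (y - z)) + ζ₂ * (y ^ (a + 1) * (z - x))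
      + ζ₃ * (z ^ (a + 1) * (x - y)) = 0 := by
    have := congrArg (Subtype.val : O → K) hrel
    push_cast at this
    rwa [hval, hval, hval] at this
  have hpow {ζ : O} (hζ : ζ ^ N = 1) : (ζ : K) ^ N = 1 := by
    exact_mod_cast congrArg (Subtype.val : O → K) hζ
  have m1 := hxyz.twist_mul_eq hN.ne' (hpow h1) (hpow h2) (hpow h3) (a + 1) hrelK
  have m2 := hxyz.rotate.twist_mul_eq hN.ne' (hpow h2) (hpow h3) (hpow h1) (a + 1)
    (by rw [← hrelK]; ring)
  have hne : (ζ₁ : K) ≠ 0 := by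
    intro h0; have := hpow h1; rw [h0, zero_pow hN.ne'] at this; exact zero_ne_one this
  -- the quotient of two twists is a cube root of unity `ω`
  set ω : K := ζ₂ / ζ₁ with hω
  have e2 : (ζ₂ : K) = ω * ζ₁ := (div_mul_cancel₀ _ hne).symm
  have hω0 : ω ≠ 0 := by
    intro h0; rw [h0, zero_mul] at e2
    have := hpow h2; rw [e2, zero_pow hN.ne'] at this; exact zero_ne_one this
  rw [e2] at m1 m2
  have e3' : ω * ζ₃ = ζ₁ := by
    refine mul_right_cancel₀ hne ?_
    linear_combination m1
  have e3 : (ζ₃ : K) = ω ^ 2 * ζ₁ := by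
    refine mul_right_cancel₀ hne ?_
    linear_combination m2
  have hω3 : ω ^ 3 = 1 := by
    refine mul_right_cancel₀ hne ?_
    rw [e3] at e3'
    linear_combination e3'
  have hcase : (ω - 1) * (ω ^ 2 + ω + 1) = 0 := by linear_combination hω3
  rw [e2, e3] at hrelK
  rcases mul_eq_zero.1 hcase with hω1 | hω1
  · -- the twists agree, so that `a` is a zero of the Tribonacci sequence
    have hω1 : ω = 1 := sub_eq_zero.1 hω1
    rw [hω1, one_mul] at e2
    rw [hω1, one_pow, one_mul] at e3
    have e2 : ζ₂ = ζ₁ := Subtype.ext e2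
    have e3 : ζ₃ = ζ₁ := Subtype.ext e3
    subst e2 e3
    have hζ0 : ζ₃ ≠ 0 := by
      rintro rfl; simp at hne
    have hV := hXYZ.vandermonde_sq
    set V := IsTribRoots.vandermonde (X : O) Y Z with hVdef
    have hTa : trib a = 0 := by
      have hb := vandermonde_mul_trib hXYZ a
      rw [← hVdef] at hb
      have h0 : ζ₃ * (V * trib a) = 0 := by rw [hb, ← hrel]; ring
      have h0' := (mul_eq_zero.1 h0).resolve_left hζ0
      have hV0 : V ≠ 0 := by
        intro hV0; simp [hV0] at hV
      have h0'' := (mul_eq_zero.1 h0').resolve_left hV0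
      exact FaithfulSMul.algebraMap_injective ℤ O (by simpa using h0'')
    -- modulo `P` the sequence starting at `l` is `ζ₃` times the sequence starting at `a`
    have hprop (k : ℤ) : V * trib (l + k) - ζ₃ * (V * trib (a + k)) ∈ P := by
      have hb := vandermonde_mul_trib hXYZ (l + k)
      have hb' := vandermonde_mul_trib hXYZ (a + k)
      rw [← hVdef] at hb hb'
      have hsplit (u : Oˣ) : ((u ^ (l + k + 1) : Oˣ) : O)
          = ((u ^ (l - a) : Oˣ) : O) * ((u ^ (a + k + 1) : Oˣ) : O) := by
        rw [← Units.val_mul, ← zpow_add]; ring_nf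
      rw [hsplit, hsplit, hsplit] at hb
      have hfin := P.add_mem (P.add_mem
        (P.mul_mem_right (((X ^ (a + k + 1) : Oˣ) : O) * (Y - Z)) h1')
        (P.mul_mem_right (((Y ^ (a + k + 1) : Oˣ) : O) * (Z - X)) h2'))
        (P.mul_mem_right (((Z ^ (a + k + 1) : Oˣ) : O) * (X - Y)) h3')
      convert hfin using 1
      rw [hb, hb']; ring
    refine hlz a (hzeros a hTa) ?_
    have hfin := P.mul_mem_left V (P.sub_mem (P.mul_mem_right (trib (a + 2) : O) (hprop 1))
      (P.mul_mem_right (trib (a + 1) : O) (hprop 2)))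
    have hfin' : ((44 * (trib (l + 1) * trib (a + 2) - trib (l + 2) * trib (a + 1)) : ℤ) : O) ∈ P := by
      rw [← neg_mem_iff]
      convert hfin using 1
      push_cast
      linear_combination (-(trib (l + 1) * trib (a + 2) - trib (l + 2) * trib (a + 1) : O)) * hV
    rw [hPmem] at hfin'
    exact (hp'.dvd_or_dvd hfin').resolve_left (by exact_mod_cast hp44)
  · refine hcube a (hxyz.trib_identity_of_cube_twist hω1 ?_)
    refine (mul_eq_zero.1 (?_ : (ζ₁ : K) * _ = 0)).resolve_left hne
    rw [← hrelK]; ring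

/-! ### Computation of Tribonacci numbers modulo `m` -/

/-- The product in `(ℤ/m)[θ]`, with `θ³ = θ² + θ + 1`, on coordinates with respect to
`1, θ, θ²`. -/
def thetaMul (m : ℕ) (u v : ℕ × ℕ × ℕ) : ℕ × ℕ × ℕ :=
  let c := u.2.1 * v.2.2 + u.2.2 * v.2.1
  let d := u.2.2 * v.2.2
  ((u.1 * v.1 + c + d) % m,
    (u.1 * v.2.1 + u.2.1 * v.1 + c + 2 * d) % m,
    (u.1 * v.2.2 + u.2.1 * v.2.1 + u.2.2 * v.1 + c + 2 * d) % m)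

/-- The coordinates of `u b ^ n` by repeated squaring, for `n < 2 ^ fuel`. -/
def thetaPowAux (m : ℕ) : ℕ → ℕ → ℕ × ℕ × ℕ → ℕ × ℕ × ℕ → ℕ × ℕ × ℕ
  | 0, _, _, u => u
  | fuel + 1, n, b, u =>
    thetaPowAux m fuel (n / 2) (thetaMul m b b) (if n % 2 = 1 then thetaMul m u b else u)

/-- The coordinates of `θ ^ n`, for `n < 2 ^ 48`. -/
def thetaPow (m n : ℕ) : ℕ × ℕ × ℕ :=
  thetaPowAux m 48 n (0, 1, 0) (1, 0, 0)

/-- The Tribonacci number `T(n)` modulo `m`, for `n < 2 ^ 48`. -/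
def tribMod (m n : ℕ) : ℕ :=
  ((thetaPow m n).2.1 + (thetaPow m n).2.2) % m

/-- The triple `u` holds the coordinates of `θ ^ n` modulo `m`, expressed through the action of
`θ` as the shift on the Tribonacci sequence. -/
def IsThetaPow (m : ℕ) (n : ℤ) (u : ℕ × ℕ × ℕ) : Prop :=
  ∀ k, (trib (k + n) : ZMod m) = u.1 * trib k + u.2.1 * trib (k + 1) + u.2.2 * trib (k + 2)

theorem IsThetaPow.mul {m : ℕ} {n n' : ℤ} {u v : ℕ × ℕ × ℕ} (hu : IsThetaPow m n u)
    (hv : IsThetaPow m n' v) : IsThetaPow m (n + n') (thetaMul m u v) := by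
  intro k
  have h3 : (trib (k + 3) : ZMod m) = trib (k + 2) + trib (k + 1) + trib k := by
    exact_mod_cast congrArg (Int.cast : ℤ → ZMod m) (trib_add_three k)
  have h4 : (trib (k + 4) : ZMod m) = trib (k + 3) + trib (k + 2) + trib (k + 1) := by
    have := congrArg (Int.cast : ℤ → ZMod m) (trib_add_three (k + 1))
    rw [show k + 1 + 3 = k + 4 by ring, show k + 1 + 2 = k + 3 by ring,
      show k + 1 + 1 = k + 2 by ring] at this
    exact_mod_cast this
  have e0 := hu k
  have e1 := hu (k + 1)
  have e2 := hu (k + 2)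
  rw [show k + 1 + 1 = k + 2 by ring, show k + 1 + 2 = k + 3 by ring, h3] at e1
  rw [show k + 2 + 1 = k + 3 by ring, show k + 2 + 2 = k + 4 by ring, h4, h3] at e2
  have e := hv (k + n)
  rw [show k + n + 1 = k + 1 + n by ring, show k + n + 2 = k + 2 + n by ring, e0, e1, e2] at e
  rw [← add_assoc, e]
  simp only [thetaMul, ZMod.natCast_mod]
  push_cast
  ring

theorem isThetaPow_thetaPowAux {m : ℕ} (fuel : ℕ) {n : ℕ} (hn : n < 2 ^ fuel) {i j : ℤ}
    {b u : ℕ × ℕ × ℕ} (hb : IsThetaPow m i b) (hu : IsThetaPow m j u) :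
    IsThetaPow m (j + n * i) (thetaPowAux m fuel n b u) := by
  induction fuel generalizing n i j b u with
  | zero =>
    obtain rfl : n = 0 := by simpa using hn
    simpa [thetaPowAux] using hu
  | succ fuel ih =>
    have hn' : n / 2 < 2 ^ fuel := by rw [pow_succ] at hn; omega
    rw [thetaPowAux]
    split_ifs with h
    · have := ih hn' (hb.mul hb) (hu.mul hb)
      rwa [show j + i + ((n / 2 : ℕ) : ℤ) * (i + i) = j + n * i by
        rw [show (n : ℤ) = 2 * ((n / 2 : ℕ) : ℤ) + 1 by omega]; ring] at this
    · have := ih hn' (hb.mul hb) hu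
      rwa [show j + ((n / 2 : ℕ) : ℤ) * (i + i) = j + n * i by
        rw [show (n : ℤ) = 2 * ((n / 2 : ℕ) : ℤ) by omega]; ring] at this

theorem isThetaPow_thetaPow (m : ℕ) {n : ℕ} (hn : n < 2 ^ 48) :
    IsThetaPow m n (thetaPow m n) := by
  have h1 : IsThetaPow m 1 (0, 1, 0) := fun k => by simp
  have h0 : IsThetaPow m 0 (1, 0, 0) := fun k => by simp
  simpa [thetaPow] using isThetaPow_thetaPowAux 48 hn h1 h0

theorem natCast_tribMod (m : ℕ) {n : ℕ} (hn : n < 2 ^ 48) :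
    (tribMod m n : ZMod m) = trib n := by
  have h := isThetaPow_thetaPow m hn 0
  rw [zero_add, zero_add, zero_add, trib_zero, trib_one, trib_two] at h
  rw [h, tribMod, ZMod.natCast_mod]
  push_cast; ring

theorem dvd_trib_iff (m : ℕ) {n : ℕ} (hn : n < 2 ^ 48) : (m : ℤ) ∣ trib n ↔ m ∣ tribMod m n := by
  rw [← ZMod.intCast_zmod_eq_zero_iff_dvd, ← natCast_tribMod m hn, ZMod.natCast_eq_zero_iff]

theorem periodic_trib_of_thetaPow {m N : ℕ} (hN : N < 2 ^ 48) (h : thetaPow m N = (1, 0, 0)) :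
    Function.Periodic (fun n : ℤ => (trib n : ZMod m)) N := fun k => by
  have := isThetaPow_thetaPow m hN k
  rw [h] at this
  simpa using this

/-! ### Verification for the individual primes -/

/-- The Tribonacci sequence has period `48` modulo `7`, and the identity fails in every class. -/
theorem trib_cube_twist_ne (a : ℤ) : 44 * trib a ^ 2
    ≠ 3 * (16 * trib (-a - 2) + 14 * (trib (-a - 3) + trib (-a - 4)) + 4 * trib (-a - 3)) := by
  intro h
  have hper := periodic_trib_of_thetaPow (m := 7) (N := 48) (by norm_num) (by decide +kernel)
  have hred {i : ℤ} {j : ℕ} (hj : j < 2 ^ 48) {q : ℤ} (hq : i = j + q * 48) :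
      (trib i : ZMod 7) = tribMod 7 j := by
    rw [natCast_tribMod 7 hj, hq]
    exact hper.int_mul q j
  obtain ⟨r, hr⟩ := Int.eq_ofNat_of_zero_le (Int.emod_nonneg a (by norm_num : (48 : ℤ) ≠ 0))
  have hr48 : r < 48 := by omega
  have hZ := congrArg (Int.cast : ℤ → ZMod 7) h
  push_cast at hZ
  rw [hred (i := a) (j := r) (by omega) (q := a / 48) (by omega),
    hred (i := -a - 2) (j := 94 - r) (by omega) (q := -(a / 48) - 2) (by omega),
    hred (i := -a - 3) (j := 93 - r) (by omega) (q := -(a / 48) - 2) (by omega),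
    hred (i := -a - 4) (j := 92 - r) (by omega) (q := -(a / 48) - 2) (by omega)] at hZ
  have key : ∀ r < 48, ¬ 44 * tribMod 7 r ^ 2 ≡ 3 * (16 * tribMod 7 (94 - r)
      + 14 * (tribMod 7 (93 - r) + tribMod 7 (92 - r)) + 4 * tribMod 7 (93 - r)) [MOD 7] := by
    decide +kernel
  refine key r hr48 ((ZMod.natCast_eq_natCast_iff _ _ _).1 ?_)
  exact_mod_cast hZ

theorem trib_eq_zero_of_mem {z : ℤ} (hz : z ∈ tribZeros) : trib z = 0 := by
  rcases hz with rfl | rfl | rfl | rfl <;> decide +kernel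

/-- The finite criterion for the valuation formula in computable form; the period `Q` is large
enough for the zeros to be represented by the natural numbers `Q`, `Q - 1`, `Q - 4`, `Q - 17`. -/
theorem tribValuationFormula_of_check {p Q : ℕ} (hp : p.Prime) (h2 : p ≠ 2)
    (hQ17 : 17 ≤ Q) (hQ48 : Q < 2 ^ 48) (hpQ : ¬ p ∣ Q) (hθ : thetaPow p Q = (1, 0, 0))
    (hzQ : ∀ c ∈ [0, 1, 4, 17], ¬ p ^ 2 ∣ tribMod (p ^ 2) (Q - c))
    (hr : ∀ r < Q, p ∣ tribMod p r → ∃ c ∈ [0, 1, 4, 17], Q ∣ r + c) :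
    TribValuationFormula p Q := by
  have hmem (c : ℕ) (hc : c ∈ [0, 1, 4, 17]) : -(c : ℤ) ∈ tribZeros := by
    simp only [List.mem_cons, List.not_mem_nil, or_false] at hc
    rcases hc with rfl | rfl | rfl | rfl <;> simp [tribZeros]
  refine tribValuationFormula_of_period hp h2 (by omega) hpQ (fun k => ?_)
    (fun z hz => trib_eq_zero_of_mem hz) (fun z hz => ?_) (fun r hrQ hd => ?_)
  · rw [← ZMod.intCast_eq_intCast_iff_dvd_sub]
    exact (periodic_trib_of_thetaPow hQ48 hθ k).symm
  · obtain ⟨c, hc, rfl⟩ : ∃ c ∈ [0, 1, 4, 17], z = -((c : ℕ) : ℤ) := by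
      rcases hz with rfl | rfl | rfl | rfl <;> simp
    have hcQ : c ≤ Q := by
      simp only [List.mem_cons, List.not_mem_nil, or_false] at hc; omega
    have := hzQ c hc
    rw [← dvd_trib_iff _ (by omega)] at this
    rw [neg_add_eq_sub, ← Nat.cast_sub hcQ]
    exact_mod_cast this
  · obtain ⟨c, hc, hdc⟩ := hr r hrQ ((dvd_trib_iff _ (by omega)).1 hd)
    refine ⟨_, hmem c hc, (Int.modEq_iff_dvd.2 ?_).symm⟩
    rw [sub_neg_eq_add]
    exact_mod_cast hdc

theorem tribValuationFormula_83 : TribValuationFormula 83 287 :=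
  tribValuationFormula_of_check (by norm_num) (by norm_num) (by norm_num) (by norm_num)
    (by norm_num) (by decide +kernel) (by decide +kernel) (by decide +kernel)

theorem tribValuationFormula_397 : TribValuationFormula 397 132 :=
  tribValuationFormula_of_check (by norm_num) (by norm_num) (by norm_num) (by norm_num)
    (by norm_num) (by decide +kernel) (by decide +kernel) (by decide +kernel)

/-- A common period of the Tribonacci sequence modulo `p`, for `p` not dividing the discriminant
`-44`: the orders `p - 1`, `p² - 1` and `p³ - 1` of the multiplicative groups of the fields that may
contain the characteristic roots divide it. -/
def tribPeriod (p : ℕ) : ℕ := (p ^ 2 - 1) * (p ^ 2 + p + 1)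

/-- The conditions under which the class of `l` refutes the conjecture for `p`. The last four say
that `(T(l + 1), T(l + 2))` is not proportional modulo `p` to `(T(z + 1), T(z + 2))` for a zero
`z = 0, -1, -4, -17`. -/
def IsRefutation (p l : ℕ) : Prop :=
  tribPeriod p + l + 2 < 2 ^ 48 ∧ p.gcd (tribPeriod p) = 1 ∧
    thetaPow p (tribPeriod p) = (1, 0, 0) ∧ p ∣ tribMod p l ∧
    ¬ tribMod (p ^ 2) (l + tribPeriod p) ≡ tribMod (p ^ 2) l [MOD p ^ 2] ∧
    ¬ tribMod p (l + 1) ≡ tribMod p (l + 2) [MOD p] ∧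
    ¬ p ∣ tribMod p (l + 1) ∧
    ¬ p ∣ tribMod p (l + 1) + tribMod p (l + 2) ∧
    ¬ p ∣ 47 * tribMod p (l + 1) + 56 * tribMod p (l + 2)

instance (p l : ℕ) : Decidable (IsRefutation p l) := by
  unfold IsRefutation; infer_instance

theorem IsRefutation.not_mlConjecture {p l : ℕ} (hp : p.Prime) (hp44 : ¬ p ∣ 44)
    (h : IsRefutation p l) : ¬ MLConjecture p := by
  obtain ⟨hb, hgcd, hθ, hl0, hl, z0, z1, z4, z17⟩ := h
  set N := tribPeriod p with hN
  have hN0 : 0 < N := by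
    refine Nat.mul_pos ?_ (by positivity)
    have := Nat.pow_le_pow_left hp.two_le 2
    omega
  have hper := periodic_trib_of_thetaPow (by omega) hθ
  have c1 := natCast_tribMod p (n := l + 1) (by omega)
  have c2 := natCast_tribMod p (n := l + 2) (by omega)
  push_cast at c1 c2
  refine not_mlConjecture_of_zero hp hp44 hN0 hgcd (l := l) (fun k => ?_)
    ((dvd_trib_iff _ (by omega)).2 hl0) (fun hd => hl ?_)
    (fun n => tribValuationFormula_83.eq_of_trib_eq_zero) (fun z hz hd => ?_) trib_cube_twist_ne
  · rw [← ZMod.intCast_eq_intCast_iff_dvd_sub]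
    exact (hper k).symm
  · rw [← ZMod.natCast_eq_natCast_iff, natCast_tribMod _ (by omega), natCast_tribMod _ (by omega)]
    refine ((ZMod.intCast_eq_intCast_iff_dvd_sub _ _ _).2 ?_).symm
    exact_mod_cast hd
  · rw [← ZMod.intCast_zmod_eq_zero_iff_dvd] at hd
    push_cast at hd
    rw [← c1, ← c2] at hd
    rcases hz with rfl | rfl | rfl | rfl
    · refine z0 ((ZMod.natCast_eq_natCast_iff _ _ _).1 ?_)
      rw [show trib (0 + 2) = 1 from rfl, show trib (0 + 1) = 1 from rfl] at hd
      linear_combination hd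
    · refine z1 ((ZMod.natCast_eq_zero_iff _ _).1 ?_)
      rw [show trib (-1 + 2) = 1 from rfl, show trib (-1 + 1) = 0 from rfl] at hd
      linear_combination hd
    · refine z4 ((ZMod.natCast_eq_zero_iff _ _).1 ?_)
      rw [show trib (-4 + 2) = 1 from rfl, show trib (-4 + 1) = -1 from rfl] at hd
      push_cast at hd ⊢
      linear_combination hd
    · refine z17 ((ZMod.natCast_eq_zero_iff _ _).1 ?_)
      rw [show trib (-17 + 2) = -47 by decide +kernel,
        show trib (-17 + 1) = 56 by decide +kernel] at hd
      push_cast at hd ⊢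
      linear_combination -hd

/-- Pairs `(p, l)` such that the class of `l` modulo `tribPeriod p` refutes the conjecture
for `p`. -/
def refutations : List (ℕ × ℕ) :=
  [(5, 19), (7, 5), (13, 6), (17, 28), (19, 18), (23, 29), (29, 77), (31, 14), (37, 19),
   (41, 35), (43, 82), (47, 31), (53, 33), (59, 64), (61, 68), (67, 100), (71, 132), (73, 31),
   (79, 18), (89, 109), (97, 19), (101, 186), (107, 184), (109, 105), (113, 172), (127, 586),
   (131, 79), (137, 11), (139, 34), (149, 10), (151, 223), (157, 71), (167, 41), (173, 314),
   (179, 100), (181, 25), (191, 72), (193, 171), (197, 382), (199, 26), (211, 83), (223, 361),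
   (227, 34), (229, 249), (233, 36), (239, 28), (241, 506), (251, 304), (257, 54), (263, 37),
   (269, 177), (271, 331), (277, 61), (281, 536), (283, 777), (293, 458), (307, 30), (311, 123),
   (313, 29), (317, 36), (331, 188), (337, 320), (347, 156), (349, 1428), (353, 95),
   (359, 1204), (367, 692), (373, 279), (379, 309), (383, 219), (389, 1739), (401, 265),
   (409, 365), (419, 277), (421, 118), (431, 465), (433, 385), (439, 781), (443, 516),
   (449, 107), (457, 858), (461, 192), (463, 624), (467, 1269), (479, 56), (487, 131),
   (491, 802), (499, 109), (503, 107), (509, 1228), (521, 2058), (523, 237), (541, 633),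
   (547, 104), (557, 509), (563, 87), (569, 322), (571, 527), (577, 39), (587, 96), (593, 849),
   (599, 257)]

theorem isRefutation_of_mem : ∀ c ∈ refutations, IsRefutation c.1 c.2 := by
  decide +kernel

/-- The table covers the required range: every other number there is a proper multiple
of a prime at most `23`. -/
theorem exists_mem_refutations : ∀ p < 600, 5 ≤ p → p ∉ [11, 83, 103, 163, 397] →
    (∃ c ∈ refutations, c.1 = p) ∨ ∃ d ∈ [2, 3, 5, 7, 11, 13, 17, 19, 23], d ∣ p ∧ d ≠ p := by
  decide +kernel

theorem mainTheorem1 :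
    (∀ p : ℕ, p.Prime → 5 ≤ p → p ≤ 599 → p ∉ ({11, 83, 103, 163, 397} : Set ℕ) →
      ¬ MLConjecture p) ∧
    (MLConjecture 83 ∧ TribValuationFormula 83 287) ∧
    (MLConjecture 397 ∧ TribValuationFormula 397 132) := by
  refine ⟨fun p hp h5 h599 hpn => ?_,
    ⟨tribValuationFormula_83.mlConjecture (by norm_num) (by norm_num), tribValuationFormula_83⟩,
    ⟨tribValuationFormula_397.mlConjecture (by norm_num) (by norm_num), tribValuationFormula_397⟩⟩
  rcases exists_mem_refutations p (by omega) h5 (by simpa using hpn) with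
    ⟨c, hc, rfl⟩ | ⟨d, hd, hdp, hne⟩
  · refine (isRefutation_of_mem c hc).not_mlConjecture hp fun h44 => ?_
    rw [show 44 = 2 ^ 2 * 11 by norm_num, hp.dvd_mul] at h44
    rcases h44 with h44 | h44
    · have := (Nat.prime_dvd_prime_iff_eq hp Nat.prime_two).1 (hp.dvd_of_dvd_pow h44)
      omega
    · have := (Nat.prime_dvd_prime_iff_eq hp (by norm_num)).1 h44
      simp [this] at hpn
  · have h1 : d ≠ 1 := by rintro rfl; simp at hd
    exact absurd ((Nat.dvd_prime hp).1 hdp) (by simp [h1, hne])
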